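/- Let $(A,\Psi)$ be a Hopf algebroid (a cogroupoid object in commutative rings, with units $\eta_L,\eta_R$, counit $\varepsilon$, comultiplication $\Delta$), where $A$ is a regular local Noetherian ring whose maximal ideal $I$ is invariant ($\eta_L(I)\Psi=\eta_R(I)\Psi$) and $\Psi$ is flat over $A$. Let $L_0$ be the zeroth left derived functor of $I$-adic completion on $A$-modules, regarded as a functor to modules over $\widehat A=L_0A=A^\wedge_I$, with natural map $\eta\colon M\to L_0M$; a module $M$ is $L$-complete if $\eta\colon M\to L_0M$ is an isomorphism. Put $\widehat\Psi=L_0\Psi$, with the induced $A$-bimodule structure, comultiplication and counit, and $\widehat\Psi\boxtimes M=L_0(\widehat\Psi\otimes_A M)$. An $L$-complete $\widehat\Psi$-comodule is an $L$-complete $\widehat A$-module $N$ with an $\widehat A$-linear, counitary and coassociative map $\widehat\psi_N\colon N\to\widehat\Psi\boxtimes N$; morphisms are the $\widehat A$-linear maps compatible with the coactions, and their sets are written $\widehat{\mathrm{Hom}}_{\widehat\Psi}$. For a $\Psi$-comodule $(M,\psi_M)$ give $L_0M$ the structure map $$L_0M\xrightarrow{L_0(\psi_M)}L_0(\Psi\otimes_A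 M)\xrightarrow{L_0(\eta\otimes\eta)}L_0(\widehat\Psi\otimes_A L_0M)=\widehat\Psi\boxtimes L_0M.$$ For an $L$-complete $\widehat\Psi$-comodule $N$ let $\nu N$ be the pullback of $A$-modules $$\begin{array}{ccc}\nu N&\xrightarrow{\;p\;}&\Psi\otimes_A N\\ {\scriptstyle i}\downarrow&&\downarrow{\scriptstyle j}\\ N&\xrightarrow{\widehat\psi_N}&\widehat\Psi\boxtimes N,\end{array}$$ where $j$ is the composite $\Psi\otimes_A N\xrightarrow{\eta\otimes 1}\widehat\Psi\otimes_A N\xrightarrow{\eta}L_0(\widehat\Psi\otimes_A N)$. Suppose that $i$ is injective and that $\rho\colon\nu N\to\Psi\otimes_A\nu N$ is a $\Psi$-coaction (left $A$-linear, counitary, coassociative) with $(1\otimes i)\circ\rho=p$. Then: 1. For every $\Psi$-comodule $M$, $L_0M$ with the above structure map is an $L$-complete $\widehat\Psi$-comodule, so that $L_0$ is a functor from $\Psi$-comodules to $L$-complete $\widehat\Psi$-comodules. 2. There is a bijection $\mathrm{Hom}_\Psi(M,\nu N)\cong\widehat{\mathrm{Hom}}_{\widehat\Psi}(L_0M,N)$,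 natural in the $\Psi$-comodule $M$, where $\nu N$ carries the coaction $\rho$; it takes $g$ to a map $h$ with $h\circ\eta=i\circ g$. 3. If $\iota$ is a right adjoint of the functor $L_0$ from $\Psi$-comodules to $L$-complete $\widehat\Psi$-comodules, then $\nu N\cong\iota N$ as $\Psi$-comodules. -/

import Mathlib

open CategoryTheory Limits
open scoped TensorProduct

universe u

/-! ### Hopf algebroids -/

/-- The tensor product `B ⊗_A C` of commutative rings, where `B` is an `A`-module through
`f : A → B` and `C` is an `A`-module through `g : A → C`. -/
def RingTensor {A B C : Type u} [CommRing A] [CommRing B] [CommRing C]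
    (f : A →+* B) (g : A →+* C) : Type u :=
  letI := f.toAlgebra
  letI := g.toAlgebra
  B ⊗[A] C

namespace RingTensor

variable {A B C D : Type u} [CommRing A] [CommRing B] [CommRing C] [CommRing D]
  (f : A →+* B) (g : A →+* C)

noncomputable instance : CommRing (RingTensor f g) :=
  letI := f.toAlgebra
  letI := g.toAlgebra
  (Algebra.TensorProduct.instCommRing : CommRing (B ⊗[A] C))

/-- The pure tensor `b ⊗ c`. -/
noncomputable def tmul (b : B) (c : C) : RingTensor f g :=
  letI := f.toAlgebra
  letI := g.toAlgebra
  b ⊗ₜ[A] c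

/-- `b ↦ b ⊗ 1`. -/
noncomputable def inl : B →+* RingTensor f g :=
  letI := f.toAlgebra
  letI := g.toAlgebra
  (Algebra.TensorProduct.includeLeft : B →ₐ[A] B ⊗[A] C).toRingHom

/-- `c ↦ 1 ⊗ c`. -/
noncomputable def inr : C →+* RingTensor f g :=
  letI := f.toAlgebra
  letI := g.toAlgebra
  (Algebra.TensorProduct.includeRight : C →ₐ[A] B ⊗[A] C).toRingHom

theorem inl_comp : (inl f g).comp f = (inr f g).comp g := by
  let _ := f.toAlgebra
  let _ := g.toAlgebra
  ext a
  exact (Algebra.TensorProduct.includeLeft : B →ₐ[A] B ⊗[A] C).commutes a |>.trans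
    ((Algebra.TensorProduct.includeRight : C →ₐ[A] B ⊗[A] C).commutes a).symm

/-- The ring homomorphism `b ⊗ c ↦ h b * k c`. -/
noncomputable def lift (h : B →+* D) (k : C →+* D) (w : h.comp f = k.comp g) :
    RingTensor f g →+* D :=
  letI := f.toAlgebra
  letI := g.toAlgebra
  letI := (h.comp f).toAlgebra
  (Algebra.TensorProduct.lift (R := A) (S := A)
    { h with commutes' := fun _ => rfl : B →ₐ[A] D }
    { k with commutes' := fun a => (RingHom.congr_fun w a).symm : C →ₐ[A] D }
    (fun _ _ => Commute.all _ _)).toRingHom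

@[simp] theorem lift_tmul (h : B →+* D) (k : C →+* D) (w : h.comp f = k.comp g) (b : B) (c : C) :
    lift f g h k w (tmul f g b c) = h b * k c := rfl

theorem inl_apply (b : B) : inl f g b = tmul f g b 1 := rfl

theorem inr_apply (c : C) : inr f g c = tmul f g 1 c := rfl

theorem tmul_mul_tmul (b b' : B) (c c' : C) :
    tmul f g b c * tmul f g b' c' = tmul f g (b * b') (c * c') :=
  let _ := f.toAlgebra
  let _ := g.toAlgebra
  Algebra.TensorProduct.tmul_mul_tmul (R := A) b b' c c'

theorem lift_comp_inl (h : B →+* D) (k : C →+* D) (w : h.comp f = k.comp g) :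
    (lift f g h k w).comp (inl f g) = h := by
  ext b
  change h b * k 1 = h b
  rw [map_one, mul_one]

theorem lift_comp_inr (h : B →+* D) (k : C →+* D) (w : h.comp f = k.comp g) :
    (lift f g h k w).comp (inr f g) = k := by
  ext c
  change h 1 * k c = k c
  rw [map_one, one_mul]

@[elab_as_elim]
theorem induction {P : RingTensor f g → Prop} (z : RingTensor f g) (zero : P 0)
    (tmul : ∀ b c, P (tmul f g b c)) (add : ∀ x y, P x → P y → P (x + y)) : P z := by
  let _ := f.toAlgebra
  let _ := g.toAlgebra
  exact TensorProduct.induction_on (motive := P) z zero tmul add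

/-- The additive map out of `B ⊗_A C` given by an `A`-balanced biadditive map. -/
noncomputable def liftAdd {G : Type u} [AddCommGroup G] (b : B →+ C →+ G)
    (w : ∀ a x y, b (x * f a) y = b x (g a * y)) : RingTensor f g →+ G :=
  letI := f.toAlgebra
  letI := g.toAlgebra
  TensorProduct.liftAddHom b (fun a x y => by
    rw [Algebra.smul_def, Algebra.smul_def, mul_comm]
    exact w a x y)

@[simp] theorem liftAdd_tmul {G : Type u} [AddCommGroup G] (b : B →+ C →+ G)
    (w : ∀ a x y, b (x * f a) y = b x (g a * y)) (x : B) (y : C) :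
    liftAdd f g b w (tmul f g x y) = b x y := rfl

end RingTensor

/-- A Hopf algebroid `(A, Ψ)`: a cogroupoid object in commutative rings. In `Ψ ⊗_A Ψ` the left
factor is an `A`-module through the right unit, the right factor through the left unit. -/
structure HopfAlgebroid (A Ψ : Type u) [CommRing A] [CommRing Ψ] where
  /-- the left unit -/
  etaL : A →+* Ψ
  /-- the right unit -/
  etaR : A →+* Ψ
  /-- the counit `ε` (identity) -/
  counit : Ψ →+* A
  /-- the comultiplication `Δ` (composition) -/
  comul : Ψ →+* RingTensor etaR etaL
  /-- the conjugation `c` (inverse) -/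
  conj : Ψ →+* Ψ
  counit_etaL : counit.comp etaL = RingHom.id A
  counit_etaR : counit.comp etaR = RingHom.id A
  comul_etaL : comul.comp etaL = (RingTensor.inl etaR etaL).comp etaL
  comul_etaR : comul.comp etaR = (RingTensor.inr etaR etaL).comp etaR
  /-- `(ε ⊗ 1) Δ = 1` -/
  counit_comul_left : (RingTensor.lift etaR etaL (etaL.comp counit) (RingHom.id Ψ)
    (by rw [RingHom.comp_assoc, counit_etaR]; rfl)).comp comul = RingHom.id Ψ
  /-- `(1 ⊗ ε) Δ = 1` -/
  counit_comul_right : (RingTensor.lift etaR etaL (RingHom.id Ψ) (etaR.comp counit)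
    (by rw [RingHom.comp_assoc, counit_etaL]; rfl)).comp comul = RingHom.id Ψ
  /-- `(Δ ⊗ 1) Δ = (1 ⊗ Δ) Δ`, as maps to `Ψ ⊗_A Ψ ⊗_A Ψ = (Ψ ⊗_A Ψ) ⊗_A Ψ` -/
  coassoc :
    (RingTensor.lift etaR etaL
      ((RingTensor.inl ((RingTensor.inr etaR etaL).comp etaR) etaL).comp comul)
      (RingTensor.inr ((RingTensor.inr etaR etaL).comp etaR) etaL)
      (by rw [RingHom.comp_assoc, comul_etaR, RingTensor.inl_comp])).comp comul =
    (RingTensor.lift etaR etaL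
      ((RingTensor.inl ((RingTensor.inr etaR etaL).comp etaR) etaL).comp
        (RingTensor.inl etaR etaL))
      ((RingTensor.lift etaR etaL
        ((RingTensor.inl ((RingTensor.inr etaR etaL).comp etaR) etaL).comp
          (RingTensor.inr etaR etaL))
        (RingTensor.inr ((RingTensor.inr etaR etaL).comp etaR) etaL)
        (by rw [RingHom.comp_assoc, RingTensor.inl_comp])).comp comul)
      (by
        rw [RingHom.comp_assoc, RingTensor.inl_comp, RingHom.comp_assoc, comul_etaL,
          ← RingHom.comp_assoc etaL (RingTensor.inl etaR etaL), RingTensor.lift_comp_inl, RingHom.comp_assoc])).comp comul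
  conj_etaL : conj.comp etaL = etaR
  conj_etaR : conj.comp etaR = etaL
  conj_conj : conj.comp conj = RingHom.id Ψ
  /-- `∑ c(x') x'' = η_R ε(x)` -/
  conj_comul_left : (RingTensor.lift etaR etaL conj (RingHom.id Ψ)
    (by rw [conj_etaR]; rfl)).comp comul = etaR.comp counit
  /-- `∑ x' c(x'') = η_L ε(x)` -/
  conj_comul_right : (RingTensor.lift etaR etaL (RingHom.id Ψ) conj
    (by rw [conj_etaL]; rfl)).comp comul = etaL.comp counit

/-! ### Bimodules and their tensor products with modules -/

/-- An `A`-bimodule over a commutative ring `A`: a (left) `A`-module with a second, commuting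
action of `A` (on the right). -/
structure BiMod (A : Type u) [CommRing A] where
  /-- the left module -/
  left : ModuleCat.{u} A
  /-- the right action: `ract a` is `b ↦ b · a` -/
  ract : A →+* End left

namespace BiMod

variable {A : Type u} [CommRing A] (B B' : BiMod A)

/-- The underlying group of a bimodule, as an `A`-module through the right action. -/
def Right : Type u := B.left

noncomputable instance : AddCommGroup B.Right := inferInstanceAs (AddCommGroup B.left)

/-- `a` acts on `b` as `b · a`. -/
noncomputable instance : Module A B.Right where
  smul a b := (B.ract a).hom b
  one_smul b := by
    change (B.ract 1).hom b = b
    rw [map_one]; rfl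
  mul_smul a a' b := by
    change (B.ract (a * a')).hom b = (B.ract a).hom ((B.ract a').hom b)
    rw [map_mul]; rfl
  smul_zero a := (B.ract a).hom.map_zero
  smul_add a := (B.ract a).hom.map_add
  add_smul a a' b := by
    change (B.ract (a + a')).hom b = (B.ract a).hom b + (B.ract a').hom b
    rw [map_add]; rfl
  zero_smul b := by
    change (B.ract 0).hom b = 0
    rw [map_zero]; rfl

/-- The left action of `a`, as a map that is linear for the right action. -/
noncomputable def lact : A →+* Module.End A B.Right where
  toFun a :=
    { toFun := fun b => LinearMap.lsmul A B.left a b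
      map_add' := fun b b' => (LinearMap.lsmul A B.left a).map_add b b'
      map_smul' := fun r b => ((B.ract r).hom.map_smul a b).symm }
  map_one' := LinearMap.ext fun (b : B.left) => one_smul A b
  map_mul' a a' := LinearMap.ext fun (b : B.left) => mul_smul a a' b
  map_zero' := LinearMap.ext fun (b : B.left) => zero_smul A b
  map_add' a a' := LinearMap.ext fun (b : B.left) => add_smul a a' b

/-- The group `B ⊗_A M`, formed with the right action of `A` on `B`. -/
def TensorObj (M : ModuleCat.{u} A) : Type u := B.Right ⊗[A] M

noncomputable instance (M : ModuleCat.{u} A) : AddCommGroup (B.TensorObj M) :=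
  inferInstanceAs (AddCommGroup (B.Right ⊗[A] M))

/-- `B ⊗_A M` is an `A`-module through the left action of `A` on `B`. -/
noncomputable instance (M : ModuleCat.{u} A) : Module A (B.TensorObj M) where
  smul a t := (B.lact a).rTensor M t
  one_smul t := by
    change (B.lact 1).rTensor M t = t
    rw [map_one]
    exact LinearMap.congr_fun (LinearMap.rTensor_id M B.Right) t
  mul_smul a a' t := by
    change (B.lact (a * a')).rTensor M t = (B.lact a).rTensor M ((B.lact a').rTensor M t)
    rw [map_mul, Module.End.mul_eq_comp, LinearMap.rTensor_comp]; rfl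
  smul_zero a := ((B.lact a).rTensor M).map_zero
  smul_add a := ((B.lact a).rTensor M).map_add
  add_smul a a' t := by
    change (B.lact (a + a')).rTensor M t = (B.lact a).rTensor M t + (B.lact a').rTensor M t
    rw [map_add, LinearMap.rTensor_add]; rfl
  zero_smul t := by
    change (B.lact 0).rTensor M t = 0
    rw [map_zero, LinearMap.rTensor_zero]; rfl

/-- The left `A`-module `B ⊗_A M`. -/
noncomputable abbrev tensorObj (M : ModuleCat.{u} A) : ModuleCat.{u} A :=
  ModuleCat.of A (B.TensorObj M)

/-- The `A`-linear map `b ↦ b ⊗ m` from `B` to `B ⊗_A M`. -/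
noncomputable def tmul {M : ModuleCat.{u} A} (m : M) : B.left ⟶ B.tensorObj M :=
  ModuleCat.ofHom (Y := B.TensorObj M)
    { toFun := fun b => TensorProduct.tmul A (M := B.Right) b m
      map_add' := fun b b' => TensorProduct.add_tmul (M := B.Right) b b' m
      map_smul' := fun _ _ => rfl }

variable {B}

theorem tmul_add {M : ModuleCat.{u} A} (m m' : M) : B.tmul (m + m') = B.tmul m + B.tmul m' := by
  ext b
  exact TensorProduct.tmul_add (M := B.Right) b m m'

theorem tmul_smul {M : ModuleCat.{u} A} (a : A) (m : M) :
    B.tmul (a • m) = B.ract a ≫ B.tmul m := by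
  ext b
  exact (TensorProduct.smul_tmul (M := B.Right) a b m).symm

@[elab_as_elim]
theorem tensor_induction {M : ModuleCat.{u} A} {P : B.tensorObj M → Prop} (z : B.tensorObj M)
    (zero : P 0) (tmul : ∀ (b : B.left) (m : M), P ((B.tmul m).hom b))
    (add : ∀ x y, P x → P y → P (x + y)) : P z :=
  TensorProduct.induction_on (R := A) (M := B.Right) (N := M) (motive := P) z zero tmul add

theorem tensor_hom_ext {M X : ModuleCat.{u} A} {f g : B.tensorObj M ⟶ X}
    (h : ∀ m : M, B.tmul m ≫ f = B.tmul m ≫ g) : f = g := by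
  ext z
  induction z using tensor_induction with
  | zero => rw [map_zero, map_zero]
  | tmul b m => exact ConcreteCategory.congr_hom (h m) b
  | add x y hx hy => rw [map_add, map_add, hx, hy]

/-- The additive map underlying `BiMod.desc`. -/
noncomputable def descAdd {M X : ModuleCat.{u} A} (φ : M →+ (B.left ⟶ X))
    (hφ : ∀ (a : A) (m : M), φ (a • m) = B.ract a ≫ φ m) : B.tensorObj M →+ X :=
  TensorProduct.liftAddHom (R := A) (M := B.Right) (N := M)
    (AddMonoidHom.mk' (fun b : B.Right =>
      AddMonoidHom.mk' (fun m : M => (φ m).hom b) (fun m m' => by rw [map_add]; rfl))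
      (fun b b' => by ext m; exact (φ m).hom.map_add b b'))
    (fun a b m => (ConcreteCategory.congr_hom (hφ a m) b).symm)

/-- The `A`-linear map `B ⊗_A M → X`, `b ⊗ m ↦ φ m b`, for an additive family `φ m : B → X` of
left `A`-linear maps that is balanced: `φ (a • m) b = φ m (b · a)`. -/
noncomputable def desc {M X : ModuleCat.{u} A} (φ : M →+ (B.left ⟶ X))
    (hφ : ∀ (a : A) (m : M), φ (a • m) = B.ract a ≫ φ m) : B.tensorObj M ⟶ X :=
  ModuleCat.ofHom (X := B.tensorObj M)
    { toFun := descAdd φ hφ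
      map_add' := (descAdd φ hφ).map_add
      map_smul' := fun a t => by
        induction t using tensor_induction with
        | zero => rw [smul_zero a, map_zero, smul_zero]
        | tmul b m => exact (φ m).hom.map_smul a b
        | add x y hx hy => rw [smul_add a, map_add, map_add, smul_add, hx, hy] }

@[simp]
theorem tmul_desc {M X : ModuleCat.{u} A} (φ : M →+ (B.left ⟶ X))
    (hφ : ∀ (a : A) (m : M), φ (a • m) = B.ract a ≫ φ m) (m : M) :
    B.tmul m ≫ desc φ hφ = φ m := rfl

variable (B)

/-- The map `1 ⊗ g : B ⊗_A M → B ⊗_A N`. -/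
noncomputable def tensorMap {M N : ModuleCat.{u} A} (g : M ⟶ N) :
    B.tensorObj M ⟶ B.tensorObj N :=
  desc (AddMonoidHom.mk' (fun m => B.tmul (g.hom m)) (fun m m' => by rw [map_add, tmul_add]))
    (fun a m => by
      change B.tmul (g.hom (a • m)) = B.ract a ≫ B.tmul (g.hom m)
      rw [map_smul, tmul_smul])

@[simp]
theorem tmul_tensorMap {M N : ModuleCat.{u} A} (g : M ⟶ N) (m : M) :
    B.tmul m ≫ B.tensorMap g = B.tmul (g.hom m) := rfl

theorem tensorMap_add {M N : ModuleCat.{u} A} (f g : M ⟶ N) :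
    B.tensorMap (f + g) = B.tensorMap f + B.tensorMap g :=
  tensor_hom_ext fun m => by
    rw [Preadditive.comp_add]
    exact tmul_add (f.hom m) (g.hom m)

theorem tensorMap_comp {M N P : ModuleCat.{u} A} (f : M ⟶ N) (g : N ⟶ P) :
    B.tensorMap (f ≫ g) = B.tensorMap f ≫ B.tensorMap g :=
  tensor_hom_ext fun _ => rfl

/-- The functor `B ⊗_A -` on `A`-modules. -/
noncomputable def tensor : ModuleCat.{u} A ⥤ ModuleCat.{u} A where
  obj M := B.tensorObj M
  map g := B.tensorMap g
  map_id _ := tensor_hom_ext fun _ => rfl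
  map_comp f g := B.tensorMap_comp f g

instance : B.tensor.Additive where
  map_add {_ _ f g} := B.tensorMap_add f g

variable {B} {B' : BiMod A}

/-- The map `f ⊗ 1 : B ⊗_A M → B' ⊗_A M` induced by a map of bimodules `f`. -/
noncomputable def whisker (f : B.left ⟶ B'.left) (hf : ∀ a, B.ract a ≫ f = f ≫ B'.ract a)
    (M : ModuleCat.{u} A) : B.tensorObj M ⟶ B'.tensorObj M :=
  desc (AddMonoidHom.mk' (fun m => f ≫ B'.tmul m)
      (fun m m' => by rw [tmul_add, Preadditive.comp_add]))
    (fun a m => by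
      change f ≫ B'.tmul (a • m) = B.ract a ≫ f ≫ B'.tmul m
      rw [tmul_smul, ← Category.assoc, ← hf, Category.assoc])

/-- Applying an additive endofunctor of `A`-modules to a bimodule. -/
noncomputable def mapFunctor (B : BiMod A) (F : ModuleCat.{u} A ⥤ ModuleCat.{u} A) [F.Additive] :
    BiMod A where
  left := F.obj B.left
  ract :=
    { toFun := fun a => F.map (B.ract a)
      map_one' := by rw [map_one]; exact F.map_id _
      map_mul' := fun a a' => by rw [map_mul]; exact F.map_comp _ _
      map_zero' := by rw [map_zero]; exact F.map_zero _ _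
      map_add' := fun a a' => by rw [map_add]; exact F.map_add }

end BiMod

/-! ### Comodules over a Hopf algebroid -/

namespace HopfAlgebroid

variable {A Ψ : Type u} [CommRing A] [CommRing Ψ] (H : HopfAlgebroid A Ψ)

/-- `Ψ` as an `A`-module through the left unit. -/
def LeftModule (_ : HopfAlgebroid A Ψ) : Type u := Ψ

noncomputable instance : AddCommGroup H.LeftModule := inferInstanceAs (AddCommGroup Ψ)

noncomputable instance : Module A H.LeftModule := Module.compHom Ψ H.etaL

/-- `Ψ` as an `A`-bimodule: `a` acts on the left by multiplication with `η_L a` and on the right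
by multiplication with `η_R a`. -/
noncomputable def biMod : BiMod A where
  left := ModuleCat.of A H.LeftModule
  ract :=
    { toFun := fun a => ModuleCat.ofHom
        { toFun := fun x : Ψ => (x * H.etaR a : Ψ)
          map_add' := fun x y : Ψ => add_mul x y (H.etaR a)
          map_smul' := fun r (x : Ψ) => mul_assoc (H.etaL r) x (H.etaR a) }
      map_one' := by
        refine ModuleCat.hom_ext (LinearMap.ext fun x : Ψ => ?_)
        change (x * H.etaR 1 : Ψ) = x
        rw [map_one, mul_one]
      map_mul' := fun a a' => by
        refine ModuleCat.hom_ext (LinearMap.ext fun x : Ψ => ?_)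
        change (x * H.etaR (a * a') : Ψ) = (x * H.etaR a') * H.etaR a
        rw [map_mul, mul_comm (H.etaR a), mul_assoc]
      map_zero' := by
        refine ModuleCat.hom_ext (LinearMap.ext fun x : Ψ => ?_)
        change (x * H.etaR 0 : Ψ) = 0
        rw [map_zero, mul_zero]
      map_add' := fun a a' => by
        refine ModuleCat.hom_ext (LinearMap.ext fun x : Ψ => ?_)
        change (x * H.etaR (a + a') : Ψ) = x * H.etaR a + x * H.etaR a'
        rw [map_add, mul_add] }

/-- The identification `x ⊗ y ↦ x ⊗ y` of the ring `Ψ ⊗_A Ψ` with the `A`-module `Ψ ⊗_A Ψ`. -/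
noncomputable def ofRingTensor : RingTensor H.etaR H.etaL →+ H.biMod.tensorObj H.biMod.left :=
  RingTensor.liftAdd _ _
    (AddMonoidHom.mk' (fun x : Ψ =>
      AddMonoidHom.mk' (fun y : Ψ => (H.biMod.tmul (M := H.biMod.left) y).hom x)
        (fun y y' => ConcreteCategory.congr_hom
          (BiMod.tmul_add (B := H.biMod) (M := H.biMod.left) y y') x))
      (fun x x' => by
        ext y
        exact (H.biMod.tmul (M := H.biMod.left) y).hom.map_add x x'))
    (fun a x y => (ConcreteCategory.congr_hom
      (BiMod.tmul_smul (B := H.biMod) (M := H.biMod.left) a y) x).symm)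

/-- The comultiplication as a map of left `A`-modules `Ψ → Ψ ⊗_A Ψ`. -/
noncomputable def comulHom : H.biMod.left ⟶ H.biMod.tensorObj H.biMod.left :=
  ModuleCat.ofHom (X := H.LeftModule)
    { toFun := fun x => H.ofRingTensor (H.comul x)
      map_add' := fun x y : Ψ => by
        rw [← map_add, ← map_add]; rfl
      map_smul' := fun a (x : Ψ) => by
        have h : ∀ z, H.ofRingTensor (RingTensor.inl H.etaR H.etaL (H.etaL a) * z) =
            a • H.ofRingTensor z := fun z => by
          induction z using RingTensor.induction with
          | zero => rw [mul_zero, map_zero, smul_zero]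
          | tmul b c =>
            rw [RingTensor.inl_apply, RingTensor.tmul_mul_tmul, one_mul]
            exact (H.biMod.tmul (M := H.biMod.left) c).hom.map_smul a b
          | add x y hx hy => rw [mul_add, map_add, map_add, smul_add, hx, hy]
        refine Eq.trans ?_ (h (H.comul x))
        change H.ofRingTensor (H.comul (H.etaL a * x)) = _
        rw [map_mul, ← RingHom.comp_apply H.comul, H.comul_etaL]
        rfl }

theorem ract_comulHom (a : A) :
    H.biMod.ract a ≫ H.comulHom = H.comulHom ≫ H.biMod.tensorMap (H.biMod.ract a) := by
  have h : ∀ z, H.ofRingTensor (z * RingTensor.inr H.etaR H.etaL (H.etaR a)) =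
      (H.biMod.tensorMap (H.biMod.ract a)).hom (H.ofRingTensor z) := fun z => by
    induction z using RingTensor.induction with
    | zero => rw [zero_mul, map_zero, map_zero]
    | tmul b c =>
      rw [RingTensor.inr_apply, RingTensor.tmul_mul_tmul, mul_one]
      rfl
    | add x y hx hy => rw [add_mul, map_add, map_add, map_add, hx, hy]
  refine ModuleCat.hom_ext (LinearMap.ext fun x : Ψ => ?_)
  refine Eq.trans ?_ (h (H.comul x))
  change H.ofRingTensor (H.comul (x * H.etaR a : Ψ)) = _
  rw [map_mul, ← RingHom.comp_apply H.comul, H.comul_etaR]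
  rfl

/-- The counit as a map of left `A`-modules `Ψ → A`. -/
noncomputable def counitHom : H.biMod.left ⟶ ModuleCat.of A A :=
  ModuleCat.ofHom (X := H.LeftModule)
    { toFun := fun x => H.counit x
      map_add' := fun x y => map_add H.counit (x : Ψ) (y : Ψ)
      map_smul' := fun a (x : Ψ) => by
        change H.counit (H.etaL a * x) = a * H.counit x
        rw [map_mul, ← RingHom.comp_apply, H.counit_etaL]
        rfl }

/-- `ε ⊗ 1 : Ψ ⊗_A M → M`, `x ⊗ m ↦ ε(x) m`. -/
noncomputable def counitTensor (M : ModuleCat.{u} A) : H.biMod.tensorObj M ⟶ M :=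
  BiMod.desc
    (AddMonoidHom.mk' (fun m => H.counitHom ≫ ModuleCat.ofHom (LinearMap.toSpanSingleton A M m))
      (fun m m' => by
        ext x
        exact smul_add (H.counit x) m m'))
    (fun a m => by
      refine ModuleCat.hom_ext (LinearMap.ext fun x : Ψ => ?_)
      change H.counit x • a • m = H.counit (x * H.etaR a : Ψ) • m
      rw [map_mul, ← RingHom.comp_apply H.counit, H.counit_etaR, mul_smul]
      rfl)

/-- `Δ ⊗ 1 : Ψ ⊗_A M → Ψ ⊗_A (Ψ ⊗_A M)`, `x ⊗ m ↦ ∑ x' ⊗ (x'' ⊗ m)`. -/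
noncomputable def comulTensor (M : ModuleCat.{u} A) :
    H.biMod.tensorObj M ⟶ H.biMod.tensorObj (H.biMod.tensorObj M) :=
  BiMod.desc
    (AddMonoidHom.mk' (fun m => H.comulHom ≫ H.biMod.tensorMap (H.biMod.tmul m))
      (fun m m' => by rw [BiMod.tmul_add, BiMod.tensorMap_add, Preadditive.comp_add]))
    (fun a m => by
      change H.comulHom ≫ H.biMod.tensorMap (H.biMod.tmul (a • m)) =
        H.biMod.ract a ≫ H.comulHom ≫ H.biMod.tensorMap (H.biMod.tmul m)
      rw [BiMod.tmul_smul, BiMod.tensorMap_comp, ← Category.assoc, ← ract_comulHom,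
        Category.assoc])

/-- An `A`-linear map `ψ : M → Ψ ⊗_A M` is a coaction if it is counitary and coassociative. -/
structure IsCoaction {M : ModuleCat.{u} A} (ψ : M ⟶ H.biMod.tensor.obj M) : Prop where
  counit : ψ ≫ H.counitTensor M = 𝟙 M
  coassoc : ψ ≫ H.comulTensor M = ψ ≫ H.biMod.tensor.map ψ

/-- A (left) `Ψ`-comodule. -/
structure Comodule where
  /-- the underlying `A`-module -/
  module : ModuleCat.{u} A
  /-- the coaction -/
  coact : module ⟶ H.biMod.tensor.obj module
  isCoaction : H.IsCoaction coact

namespace Comodule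

variable {H}

/-- A morphism of `Ψ`-comodules: an `A`-linear map that commutes with the coactions. -/
@[ext]
structure Hom (M N : H.Comodule) where
  /-- the underlying `A`-linear map -/
  hom : M.module ⟶ N.module
  comm : M.coact ≫ H.biMod.tensor.map hom = hom ≫ N.coact

/-- The category `Comod_Ψ`. -/
instance : Category H.Comodule where
  Hom := Hom
  id M := ⟨𝟙 _, by rw [CategoryTheory.Functor.map_id, Category.comp_id, Category.id_comp]⟩
  comp f g := ⟨f.hom ≫ g.hom, by
    rw [Functor.map_comp, ← Category.assoc, f.comm, Category.assoc, g.comm, Category.assoc]⟩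

@[ext]
theorem hom_ext {M N : H.Comodule} {f g : M ⟶ N} (h : f.hom = g.hom) : f = g := Hom.ext h

@[simp] theorem id_hom (M : H.Comodule) : (𝟙 M : M ⟶ M).hom = 𝟙 M.module := rfl

@[simp] theorem comp_hom {M N P : H.Comodule} (f : M ⟶ N) (g : N ⟶ P) :
    (f ≫ g).hom = f.hom ≫ g.hom := rfl

end Comodule

end HopfAlgebroid

/-! ### `L`-completion -/

section LCompletion

variable {A : Type u} [CommRing A] (I : Ideal A)

/-- The `I`-adic completion functor `C^I`, from `A`-modules to modules over the `I`-adic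
completion `Â` of `A`. -/
noncomputable def adicFunctor : ModuleCat.{u} A ⥤ ModuleCat.{u} (AdicCompletion I A) where
  obj M := ModuleCat.of (AdicCompletion I A) (AdicCompletion I M)
  map f := ModuleCat.ofHom (AdicCompletion.map I f.hom)
  map_id M := ModuleCat.hom_ext (AdicCompletion.map_id I M)
  map_comp f g := ModuleCat.hom_ext (LinearMap.ext fun x =>
    (AdicCompletion.map_comp_apply I f.hom g.hom x).symm)

instance : (adicFunctor I).Additive where
  map_add {M N f g} := ModuleCat.hom_ext (LinearMap.ext fun x => by
    induction x using AdicCompletion.induction_on with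
    | _ a => rfl)

/-- The `L`-completion functor `L_0`: the zeroth left derived functor of `I`-adic completion. -/
noncomputable def L0 : ModuleCat.{u} A ⥤ ModuleCat.{u} (AdicCompletion I A) :=
  (adicFunctor I).leftDerived 0

instance : (L0 I).Additive where
  map_add {X Y f g} := by
    let P := projectiveResolution X
    let Q := projectiveResolution Y
    have h := fun (k : X ⟶ Y) (φ : P.complex ⟶ Q.complex)
      (w : φ ≫ Q.π = P.π ≫ (ChainComplex.single₀ (ModuleCat.{u} A)).map k) =>
      Functor.leftDerived_map_eq (adicFunctor I) 0 k φ w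
    have hf := ProjectiveResolution.lift_commutes f P Q
    have hg := ProjectiveResolution.lift_commutes g P Q
    unfold L0
    rw [h f _ hf, h g _ hg, h (f + g) (ProjectiveResolution.lift f P Q +
      ProjectiveResolution.lift g P Q) (by
        rw [Preadditive.add_comp, hf, hg, Functor.map_add, Preadditive.comp_add]),
      Functor.map_add, Preadditive.add_comp, Preadditive.comp_add]

/-- The natural map `L_0 M → C^I M`. -/
noncomputable def L0ToAdic : L0 I ⟶ adicFunctor I := (adicFunctor I).fromLeftDerivedZero

/-- The forgetful functor from modules over the completion `Â` of `A` to `A`-modules. -/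
noncomputable abbrev res : ModuleCat.{u} (AdicCompletion I A) ⥤ ModuleCat.{u} A :=
  ModuleCat.restrictScalars (algebraMap A (AdicCompletion I A))

instance : (L0 I ⋙ res I).Additive := inferInstance

/-- The natural map `M → C^I M`. -/
noncomputable def adicUnit : 𝟭 (ModuleCat.{u} A) ⟶ adicFunctor I ⋙ res I where
  app M := ModuleCat.ofHom (Y := (res I).obj ((adicFunctor I).obj M))
    { toFun := fun m => AdicCompletion.of I M m
      map_add' := (AdicCompletion.of I M).map_add
      map_smul' := fun a m => by
        refine ((AdicCompletion.of I M).map_smul a m).trans ?_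
        exact (algebraMap_smul (AdicCompletion I A) a (AdicCompletion.of I M m)).symm }
  naturality M N f := by
    ext m
    exact (AdicCompletion.map_of I f.hom m).symm

/-- The natural map `Â ⊗_A M → C^I M`. -/
noncomputable def extToAdic :
    ModuleCat.extendScalars.{u, u, u} (algebraMap A (AdicCompletion I A)) ⟶ adicFunctor I :=
  Functor.whiskerRight (adicUnit I) (ModuleCat.extendScalars _) ≫
    Functor.whiskerLeft (adicFunctor I)
      (ModuleCat.extendRestrictScalarsAdj (algebraMap A (AdicCompletion I A))).counit

instance : (ModuleCat.extendScalars.{u, u, u} (algebraMap A (AdicCompletion I A))).Additive :=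
  (ModuleCat.extendRestrictScalarsAdj.{u, u, u}
    (algebraMap A (AdicCompletion I A))).left_adjoint_additive

/-- The natural map `η : M → L_0 M`: since `Â ⊗_A -` is right exact it is its own zeroth left
derived functor, and `η` is the composite `M → Â ⊗_A M → L_0 M` of the canonical map with the map
of zeroth left derived functors induced by `Â ⊗_A - → C^I`. -/
noncomputable def lUnit : 𝟭 (ModuleCat.{u} A) ⟶ L0 I ⋙ res I :=
  (ModuleCat.extendRestrictScalarsAdj (algebraMap A (AdicCompletion I A))).unit ≫
    Functor.whiskerRight
      ((ModuleCat.extendScalars (algebraMap A (AdicCompletion I A))).leftDerivedZeroIsoSelf.inv ≫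
        NatTrans.leftDerived (extToAdic I) 0) (res I)

end LCompletion

/-! ### `L`-complete comodules -/

namespace HopfAlgebroid

variable {A Ψ : Type u} [CommRing A] [CommRing Ψ] (H : HopfAlgebroid A Ψ) (I : Ideal A)

/-- `Ψ̂ = L_0 Ψ` as an `A`-bimodule, the right action being induced by functoriality. -/
noncomputable def hatBiMod : BiMod A := H.biMod.mapFunctor (L0 I ⋙ res I)

/-- The functor `M ↦ Ψ̂ ⊠ M = L_0 (Ψ̂ ⊗_A M)`, with values in `Â`-modules. The tensor product
inside `L_0` is taken over `A`; taking it over `Â` gives the same `L`-completion. -/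
noncomputable def box : ModuleCat.{u} A ⥤ ModuleCat.{u} (AdicCompletion I A) :=
  (H.hatBiMod I).tensor ⋙ L0 I

instance : (H.box I).Additive := inferInstanceAs ((H.hatBiMod I).tensor ⋙ L0 I).Additive

/-- The map `η ⊗ 1 : Ψ ⊗_A M → Ψ̂ ⊗_A M`. -/
noncomputable def etaTensor (M : ModuleCat.{u} A) :
    H.biMod.tensor.obj M ⟶ (H.hatBiMod I).tensor.obj M :=
  BiMod.whisker (B := H.biMod) (B' := H.hatBiMod I) ((lUnit I).app H.biMod.left)
    (fun a => (lUnit I).naturality (H.biMod.ract a)) M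

/-- The map `η ⊗ η : Ψ ⊗_A M → Ψ̂ ⊗_A L_0 M`. -/
noncomputable def etaEta (M : ModuleCat.{u} A) :
    H.biMod.tensor.obj M ⟶ (H.hatBiMod I).tensor.obj ((res I).obj ((L0 I).obj M)) :=
  H.etaTensor I M ≫ (H.hatBiMod I).tensor.map ((lUnit I).app M)

theorem etaTensor_naturality {M N : ModuleCat.{u} A} (f : M ⟶ N) :
    H.biMod.tensor.map f ≫ H.etaTensor I N =
      H.etaTensor I M ≫ (H.hatBiMod I).tensor.map f :=
  BiMod.tensor_hom_ext fun _ => rfl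

theorem etaEta_naturality {M N : ModuleCat.{u} A} (f : M ⟶ N) :
    H.biMod.tensor.map f ≫ H.etaEta I N =
      H.etaEta I M ≫ (H.hatBiMod I).tensor.map ((res I).map ((L0 I).map f)) := by
  have h := (lUnit I).naturality f
  simp only [Functor.id_map, Functor.comp_map] at h
  unfold etaEta
  rw [← Category.assoc, etaTensor_naturality, Category.assoc, Category.assoc,
    ← Functor.map_comp, ← Functor.map_comp]
  exact congrArg (fun k => H.etaTensor I M ≫ (H.hatBiMod I).tensor.map k) h

/-- The completed comultiplication `Ψ̂ = L_0 Ψ → L_0 (Ψ ⊗_A Ψ) → L_0 (Ψ̂ ⊗_A Ψ̂) = Ψ̂ ⊠ Ψ̂`. -/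
noncomputable def hatComul :
    (L0 I).obj H.biMod.left ⟶ (H.box I).obj (H.hatBiMod I).left :=
  (L0 I).map (H.comulHom ≫ H.etaEta I H.biMod.left)

/-- The completed counit `Ψ̂ = L_0 Ψ → L_0 A → Â`. -/
noncomputable def hatCounit :
    (L0 I).obj H.biMod.left ⟶ (adicFunctor I).obj (ModuleCat.of A A) :=
  (L0 I).map H.counitHom ≫ (L0ToAdic I).app (ModuleCat.of A A)

/-- For an element `n` of an `Â`-module `N`, the map `Â → N`, `x ↦ x • n`. -/
noncomputable def _root_.hatToSpanSingleton (N : ModuleCat.{u} (AdicCompletion I A)) (n : N) :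
    (adicFunctor I).obj (ModuleCat.of A A) ⟶ N :=
  ModuleCat.ofHom (X := AdicCompletion I A)
    { toFun := fun x : AdicCompletion I A => x • n
      map_add' := fun x y : AdicCompletion I A => add_smul x y n
      map_smul' := fun r (x : AdicCompletion I A) => mul_smul r x n }

theorem hatCounit_ract (a : A) :
    (L0 I).map (H.biMod.ract a) ≫ H.hatCounit I =
      H.hatCounit I ≫ (adicFunctor I).map (ModuleCat.ofHom (LinearMap.lsmul A A a)) := by
  have h : H.biMod.ract a ≫ H.counitHom =
      H.counitHom ≫ ModuleCat.ofHom (LinearMap.lsmul A A a) := by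
    refine ModuleCat.hom_ext (LinearMap.ext fun x : Ψ => ?_)
    change H.counit (x * H.etaR a : Ψ) = a * H.counit x
    rw [map_mul, ← RingHom.comp_apply H.counit, H.counit_etaR, mul_comm]
    rfl
  unfold hatCounit
  rw [← Category.assoc, ← Functor.map_comp, h, Functor.map_comp, Category.assoc, Category.assoc]
  rw [(L0ToAdic I).naturality]

/-- `ε̂ ⊗ 1 : Ψ̂ ⊗_A N → N`, `x ⊗ n ↦ ε̂(x) n`, for an `Â`-module `N`. -/
noncomputable def hatCounitTensor (N : ModuleCat.{u} (AdicCompletion I A)) :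
    (H.hatBiMod I).tensor.obj ((res I).obj N) ⟶ (res I).obj N :=
  BiMod.desc (B := H.hatBiMod I) (M := (res I).obj N)
    (AddMonoidHom.mk' (fun n => (res I).map (H.hatCounit I ≫ hatToSpanSingleton I N n))
      (fun n n' => by
        ext x
        exact smul_add (M := AdicCompletion I A) (A := N) ((H.hatCounit I).hom x) n n'))
    (fun a n => by
      change (res I).map _ = (res I).map ((L0 I).map (H.biMod.ract a)) ≫ (res I).map _
      rw [← Functor.map_comp, ← Category.assoc, hatCounit_ract, Category.assoc]
      refine congrArg (fun k => (res I).map (H.hatCounit I ≫ k)) ?_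
      refine ModuleCat.hom_ext (LinearMap.ext fun x : AdicCompletion I A => ?_)
      change x • (algebraMap A (AdicCompletion I A) a • (n : N)) =
        (AdicCompletion.map I (LinearMap.lsmul A A a) x : AdicCompletion I A) • (n : N)
      rw [← mul_smul]
      congr 1
      induction x using AdicCompletion.induction_on with
      | _ b =>
        rw [mul_comm]
        exact AdicCompletion.ext fun n => rfl)

theorem ract_hatComul (a : A) :
    (L0 I).map (H.biMod.ract a) ≫ H.hatComul I =
      H.hatComul I ≫ (H.box I).map ((H.hatBiMod I).ract a) := by
  have h : H.biMod.ract a ≫ H.comulHom ≫ H.etaEta I H.biMod.left =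
      (H.comulHom ≫ H.etaEta I H.biMod.left) ≫
        (H.hatBiMod I).tensor.map ((H.hatBiMod I).ract a) :=
    (congrArg (fun k => k ≫ H.etaEta I H.biMod.left) (H.ract_comulHom a)).trans
      (congrArg (fun k => H.comulHom ≫ k) (H.etaEta_naturality I (H.biMod.ract a)))
  exact ((L0 I).map_comp _ _).symm.trans ((congrArg (L0 I).map h).trans ((L0 I).map_comp _ _))

/-- The map `y ↦ η (y ⊗ n)` from `Ψ̂` to `Ψ̂ ⊠ N = L_0 (Ψ̂ ⊗_A N)`. -/
noncomputable def hatTmul {N : ModuleCat.{u} A} (n : N) :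
    (H.hatBiMod I).left ⟶ (res I).obj ((H.box I).obj N) :=
  (H.hatBiMod I).tmul n ≫ (lUnit I).app ((H.hatBiMod I).tensorObj N)

/-- `Δ̂ ⊗ 1` followed by the associativity `(Ψ̂ ⊠ Ψ̂) ⊗_A N → Ψ̂ ⊠ (Ψ̂ ⊠ N)`: the map
`Ψ̂ ⊗_A N → Ψ̂ ⊠ (Ψ̂ ⊠ N)` that sends `x ⊗ n` to the image of `Δ̂(x) ∈ Ψ̂ ⊠ Ψ̂` under
`1 ⊠ (y ↦ η (y ⊗ n)) : Ψ̂ ⊠ Ψ̂ → Ψ̂ ⊠ (Ψ̂ ⊠ N)`. -/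
noncomputable def hatComulTensor (N : ModuleCat.{u} A) :
    (H.hatBiMod I).tensor.obj N ⟶
      (res I).obj ((H.box I).obj ((res I).obj ((H.box I).obj N))) :=
  BiMod.desc (B := H.hatBiMod I)
    (AddMonoidHom.mk' (fun n => (res I).map (H.hatComul I ≫ (H.box I).map (H.hatTmul I n)))
      (fun n n' => by
        have h : H.hatTmul I (n + n') = H.hatTmul I n + H.hatTmul I n' :=
          (congrArg (fun k => k ≫ (lUnit I).app ((H.hatBiMod I).tensorObj N))
            (BiMod.tmul_add n n')).trans (Preadditive.add_comp _ _ _ _ _ _)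
        rw [h, Functor.map_add, Preadditive.comp_add]
        exact (res I).map_add))
    (fun a n => by
      have h : H.hatTmul I (a • n) = (H.hatBiMod I).ract a ≫ H.hatTmul I n :=
        congrArg (fun k => k ≫ (lUnit I).app ((H.hatBiMod I).tensorObj N))
          (BiMod.tmul_smul a n)
      change (res I).map (H.hatComul I ≫ (H.box I).map (H.hatTmul I (a • n))) =
        (res I).map ((L0 I).map (H.biMod.ract a)) ≫
          (res I).map (H.hatComul I ≫ (H.box I).map (H.hatTmul I n))
      rw [h, ← Functor.map_comp, ← Category.assoc, ract_hatComul, Functor.map_comp (H.box I),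
        Category.assoc])

/-- An `Â`-linear map `ψ : N → Ψ̂ ⊠ N` on an `Â`-module `N` makes `N` an `L`-complete
`Ψ̂`-comodule if `N` is `L`-complete (that is, `η : N → L_0 N` is an isomorphism) and `ψ` is
counitary and coassociative. As `η` is invertible on `N` and on `Ψ̂ ⊠ (Ψ̂ ⊠ N)`, the two
identities are written after composition with `η`, in `L_0 N` and in `L_0 (Ψ̂ ⊠ (Ψ̂ ⊠ N))`. -/
structure IsLComplete {N : ModuleCat.{u} (AdicCompletion I A)}
    (ψ : N ⟶ (H.box I).obj ((res I).obj N)) : Prop where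
  complete : IsIso ((lUnit I).app ((res I).obj N))
  counit : (res I).map (ψ ≫ (L0 I).map (H.hatCounitTensor I N)) =
    (lUnit I).app ((res I).obj N)
  coassoc : (res I).map (ψ ≫ (L0 I).map (H.hatComulTensor I ((res I).obj N))) =
    (res I).map (ψ ≫ (H.box I).map ((res I).map ψ)) ≫ (lUnit I).app _

/-- An `Â`-module `N` with an `Â`-linear map `N → Ψ̂ ⊠ N`. -/
structure PreLComodule where
  /-- the underlying `Â`-module -/
  module : ModuleCat.{u} (AdicCompletion I A)
  /-- the (completed) coaction -/
  coact : module ⟶ (H.box I).obj ((res I).obj module)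

namespace PreLComodule

variable {H I}

/-- A morphism: an `Â`-linear map that commutes with the coactions. -/
@[ext]
structure Hom (M N : H.PreLComodule I) where
  /-- the underlying `Â`-linear map -/
  hom : M.module ⟶ N.module
  comm : M.coact ≫ (H.box I).map ((res I).map hom) = hom ≫ N.coact

noncomputable instance : Category (H.PreLComodule I) where
  Hom := Hom
  id M := ⟨𝟙 _, by
    rw [CategoryTheory.Functor.map_id, CategoryTheory.Functor.map_id, Category.comp_id,
      Category.id_comp]⟩
  comp f g := ⟨f.hom ≫ g.hom, by
    rw [Functor.map_comp, Functor.map_comp, ← Category.assoc, f.comm, Category.assoc, g.comm,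
      Category.assoc]⟩

@[ext]
theorem hom_ext {M N : H.PreLComodule I} {f g : M ⟶ N} (h : f.hom = g.hom) : f = g := Hom.ext h

@[simp] theorem id_hom (M : H.PreLComodule I) : (𝟙 M : M ⟶ M).hom = 𝟙 M.module := rfl

@[simp] theorem comp_hom {M N P : H.PreLComodule I} (f : M ⟶ N) (g : N ⟶ P) :
    (f ≫ g).hom = f.hom ≫ g.hom := rfl

end PreLComodule

/-- The property of being an `L`-complete `Ψ̂`-comodule. -/
def isLComodule : ObjectProperty (H.PreLComodule I) := fun N => H.IsLComplete I N.coact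

/-- The category of `L`-complete `Ψ̂`-comodules. -/
abbrev LComodule := (H.isLComodule I).FullSubcategory

/-- The functor `M ↦ L_0 M`; the coaction of `L_0 M` is the composite
`L_0 M → L_0 (Ψ ⊗_A M) → L_0 (Ψ̂ ⊗_A L_0 M) = Ψ̂ ⊠ L_0 M` of `L_0 (ψ_M)` and `L_0 (η ⊗ η)`. -/
noncomputable def preL0 : H.Comodule ⥤ H.PreLComodule I where
  obj M :=
    { module := (L0 I).obj M.module
      coact := (L0 I).map (M.coact ≫ H.etaEta I M.module) }
  map {M N} f :=
    { hom := (L0 I).map f.hom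
      comm := by
        unfold box
        rw [Functor.comp_map, ← Functor.map_comp, ← Functor.map_comp, Category.assoc,
          ← etaEta_naturality, ← Category.assoc, f.comm, Category.assoc] }
  map_id M := PreLComodule.hom_ext ((L0 I).map_id _)
  map_comp f g := PreLComodule.hom_ext ((L0 I).map_comp _ _)

/-- The map `j : Ψ ⊗_A N → Ψ̂ ⊗_A N → L_0 (Ψ̂ ⊗_A N) = Ψ̂ ⊠ N`. -/
noncomputable def jMap (N : ModuleCat.{u} A) :
    H.biMod.tensor.obj N ⟶ (res I).obj ((H.box I).obj N) :=
  H.etaTensor I N ≫ (lUnit I).app ((H.hatBiMod I).tensor.obj N)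

/-- The pullback `ν N` of `A`-modules of `ψ̂_N : N → Ψ̂ ⊠ N` and `j : Ψ ⊗_A N → Ψ̂ ⊠ N`. -/
noncomputable def nu (N : H.PreLComodule I) : ModuleCat.{u} A :=
  pullback ((res I).map N.coact) (H.jMap I ((res I).obj N.module))

/-- The projection `i : ν N → N`. -/
noncomputable def nuI (N : H.PreLComodule I) : H.nu I N ⟶ (res I).obj N.module :=
  pullback.fst _ _

/-- The projection `p : ν N → Ψ ⊗_A N`. -/
noncomputable def nuP (N : H.PreLComodule I) :
    H.nu I N ⟶ H.biMod.tensor.obj ((res I).obj N.module) :=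
  pullback.snd _ _

/-- `ν N` with a given coaction `ρ`, as an object of `Comod_Ψ`. -/
noncomputable def nuComodule (N : H.PreLComodule I)
    (ρ : H.nu I N ⟶ H.biMod.tensor.obj (H.nu I N)) (hρ : H.IsCoaction ρ) : H.Comodule where
  module := H.nu I N
  coact := ρ
  isCoaction := hρ

/-- The functor `L_0 : Comod_Ψ → L`-complete `Ψ̂`-comodules, given that every `L_0 M` is an
`L`-complete `Ψ̂`-comodule. -/
noncomputable def L0Comodule (hL : ∀ M : H.Comodule, H.isLComodule I ((H.preL0 I).obj M)) :
    H.Comodule ⥤ H.LComodule I :=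
  (H.isLComodule I).lift (H.preL0 I) hL

end HopfAlgebroid

/-! ### Exactness of adic completion and flatness -/

/-! The heart of the matter is that η : M → L_0 M is universal among `A`-linear maps from M to
L-complete Â-modules (`existsUnique_lUnit_comp_eq`). This is formal once η is an isomorphism on
every L_0 M (`isIso_lUnit_L0`) and every L_0(η) is surjective (`L0_map_lUnit_surjective`). Since L_0
is right exact, both reduce to projective M, where L_0 M is the adic completion. That completion is
flat and adically complete, and on flat modules L_0 agrees with completion
(`isIso_L0ToAdic_of_flat`). Both uses of flatness rest on one criterion: completion preserves
exactness when the maps satisfy an Artin-Rees estimate (`AdicCompletion.exact_map_of_adicStrict`).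
The Artin-Rees lemma gives the estimate for finite modules, with the same constant for their direct
sums; for a surjection onto a flat module, flatness gives it for the map onto the kernel.

Part 1: the completed counit and comultiplication restrict along η ⊗ η to the ordinary ones, so the
axioms for L_0 M are L_0 of the axioms for M (`isLComplete_L0`).

Part 2: a map h : L_0 M → N is the same as f = h ∘ η : M → N. Because Ψ̂ ⊠ N is L-complete, h
respects coactions exactly when ψ̂_N ∘ f = j ∘ (1 ⊗ f) ∘ ψ_M (`lUnit_comp_coact_comp_box_map`), that
is, when f and (1 ⊗ f) ∘ ψ_M are the two components of a map g into the pullback νN. As p = (1 ⊗ i)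
∘ ρ and 1 ⊗ i is injective by flatness, the condition p ∘ g = (1 ⊗ f) ∘ ψ_M says precisely that g is
a comodule map.

Part 3: νN and ιN represent the same functor. -/

section AdicExactness

variable {R : Type*} [CommRing R] (I : Ideal R)
  {M N P : Type*} [AddCommGroup M] [Module R M] [AddCommGroup N] [Module R N]
  [AddCommGroup P] [Module R P]

/-- A linear map satisfies the Artin-Rees condition with constant `c` if each element of its range
that lies in `I ^ (n + c) N` is the image of an element of `I ^ n M`. -/
def LinearMap.AdicStrict (f : M →ₗ[R] N) (c : ℕ) : Prop :=
  ∀ (n : ℕ) (x : M), f x ∈ (I ^ (n + c) • ⊤ : Submodule R N) →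
    ∃ u ∈ (I ^ n • ⊤ : Submodule R M), f u = f x

variable {I}

theorem LinearMap.adicStrict_of_surjective {f : M →ₗ[R] N} (hf : Function.Surjective f) :
    f.AdicStrict I 0 := by
  intro n x hx
  have h : (I ^ n • ⊤ : Submodule R N) = (I ^ n • ⊤ : Submodule R M).map f := by
    rw [Submodule.map_smul'', Submodule.map_top, LinearMap.range_eq_top.2 hf]
  rw [add_zero, h] at hx
  exact hx

/-- The Artin-Rees lemma for the range of `f`: I^(n+c) N ∩ im f = I^n (I^c N ∩ im f), which lies in
f(I^n M). -/
theorem LinearMap.exists_adicStrict [IsNoetherianRing R] [Module.Finite R N] (f : M →ₗ[R] N) :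
    ∃ c, f.AdicStrict I c := by
  obtain ⟨c, hc⟩ := Ideal.exists_pow_inf_eq_pow_smul I (LinearMap.range f)
  refine ⟨c, fun n x hx => ?_⟩
  have h : f x ∈ I ^ (n + c) • ⊤ ⊓ LinearMap.range f := ⟨hx, x, rfl⟩
  rw [hc (n + c) (Nat.le_add_left c n), Nat.add_sub_cancel] at h
  have h' := (smul_mono_right (I ^ n) inf_le_right :
    I ^ n • (I ^ c • ⊤ ⊓ LinearMap.range f) ≤ I ^ n • LinearMap.range f) h
  rw [← Submodule.map_top, ← Submodule.map_smul''] at h'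
  exact h'

theorem Finsupp.mem_smul_top_of_forall {ι : Type*} (J : Ideal R) (x : ι →₀ M)
    (h : ∀ i, x i ∈ (J • ⊤ : Submodule R M)) : x ∈ (J • ⊤ : Submodule R (ι →₀ M)) := by
  rw [← Finsupp.sum_single x]
  refine Submodule.sum_mem _ fun i _ => ?_
  have := Submodule.mem_map_of_mem (f := Finsupp.lsingle (R := R) i) (h i)
  rw [Submodule.map_smul''] at this
  exact Submodule.smul_mono le_rfl le_top this

theorem Finsupp.apply_mem_smul_top {ι : Type*} (J : Ideal R) (x : ι →₀ M)
    (h : x ∈ (J • ⊤ : Submodule R (ι →₀ M))) (i : ι) : x i ∈ (J • ⊤ : Submodule R M) := by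
  have := Submodule.mem_map_of_mem (f := Finsupp.lapply (R := R) i) h
  rw [Submodule.map_smul''] at this
  exact Submodule.smul_mono le_rfl le_top this

theorem LinearMap.AdicStrict.mapRange {f : M →ₗ[R] N} {c : ℕ} (hf : f.AdicStrict I c)
    (ι : Type*) : (Finsupp.mapRange.linearMap (α := ι) f).AdicStrict I c := by
  intro n x hx
  have h : ∀ i, ∃ u ∈ (I ^ n • ⊤ : Submodule R M), f u = f (x i) := fun i =>
    hf n (x i) (Finsupp.apply_mem_smul_top _ _ hx i)
  choose u hu hfu using h
  classical
  -- The chosen preimage of 0 need not be 0, so it is replaced by 0 off the support of `x` to keep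
  -- the family finitely supported.
  refine ⟨Finsupp.onFinset x.support (fun i => if x i = 0 then 0 else u i) (fun i hi => ?_),
    Finsupp.mem_smul_top_of_forall _ _ fun i => ?_, Finsupp.ext fun i => ?_⟩
  · rw [Finsupp.mem_support_iff]
    exact fun h => hi (if_pos h)
  · rw [Finsupp.onFinset_apply]
    split_ifs
    exacts [zero_mem _, hu i]
  · rw [Finsupp.mapRange.linearMap_apply, Finsupp.mapRange.linearMap_apply,
      Finsupp.mapRange_apply, Finsupp.mapRange_apply, Finsupp.onFinset_apply]
    split_ifs with h
    · rw [h]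
    · exact hfu i

theorem Finsupp.exact_mapRange {f : M →ₗ[R] N} {g : N →ₗ[R] P} (h : Function.Exact f g)
    (ι : Type*) : Function.Exact (Finsupp.mapRange.linearMap (α := ι) f)
      (Finsupp.mapRange.linearMap (α := ι) g) := by
  intro y
  constructor
  · intro hy
    have : ∀ i, ∃ x, f x = y i := fun i => (h (y i)).1 (DFunLike.congr_fun hy i)
    choose x hx using this
    classical
    refine ⟨Finsupp.onFinset y.support (fun i => if y i = 0 then 0 else x i) (fun i hi => ?_),
      Finsupp.ext fun i => ?_⟩
    · rw [Finsupp.mem_support_iff]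
      exact fun h => hi (if_pos h)
    · rw [Finsupp.mapRange.linearMap_apply, Finsupp.mapRange_apply, Finsupp.onFinset_apply]
      split_ifs with h
      · rw [h, _root_.map_zero]
      · exact hx i
  · rintro ⟨x, rfl⟩
    exact Finsupp.ext fun i => h.apply_apply_eq_zero (x i)

/-- Preimages of the terms of a Cauchy sequence need not be Cauchy. Strictness of `g` moves the
terms into the range of `f`, and strictness of `f` then replaces the successive differences of
preimages by small ones. -/
theorem AdicCompletion.exact_map_of_adicStrict {f : M →ₗ[R] N} {g : N →ₗ[R] P}
    (h : Function.Exact f g) {c d : ℕ} (hf : f.AdicStrict I d) (hg : g.AdicStrict I c) :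
    Function.Exact (AdicCompletion.map I f) (AdicCompletion.map I g) := by
  intro y
  constructor
  · induction y using AdicCompletion.induction_on with | _ y
    intro hy
    have hle : ∀ (k m : ℕ), m ≤ k → (I ^ k • ⊤ : Submodule R N) ≤ I ^ m • ⊤ := fun k m hm =>
      Submodule.smul_mono_left (Ideal.pow_le_pow_right hm)
    have hgy : ∀ n, g (y n) ∈ (I ^ n • ⊤ : Submodule R P) := fun n => by
      simpa using congrArg (fun x => x.val n) hy
    have hyn : ∀ m n, m ≤ n → y n - y m ∈ (I ^ m • ⊤ : Submodule R N) := fun m n hmn =>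
      (Submodule.Quotient.eq _).1 (AdicCompletion.AdicCauchySequence.mk_eq_mk hmn y)
    -- Starting from the term of index n + c costs `c` powers of I and leaves a correction `t n`
    -- still in I^n N.
    choose t ht hgt using fun n => hg n (y (n + c)) (hgy (n + c))
    have hw : ∀ n, ∃ w, f w = y (n + c) - t n := fun n =>
      (h _).1 (by rw [map_sub, hgt, sub_self])
    choose w hw using hw
    -- The second shift, by `d`, is what strictness of `f` consumes: `e n` lies in I^n M and has the
    -- same image as the difference of preimages.
    have hd : ∀ n, f (w (n + 1 + d) - w (n + d)) ∈ (I ^ (n + d) • ⊤ : Submodule R N) := by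
      intro n
      rw [map_sub, hw, hw, sub_sub_sub_comm]
      refine sub_mem (hle _ _ ?_ (hyn (n + d + c) (n + 1 + d + c) (by omega)))
        (sub_mem (hle _ _ ?_ (ht _)) (ht _)) <;> omega
    choose e he hfe using fun n => hf n _ (hd n)
    -- Summing the small differences gives a Cauchy sequence whose image differs from `y n` only by
    -- elements of I^n N.
    let x : ℕ → M := fun n => w d + ∑ i ∈ Finset.range n, e i
    have hx : ∀ n, f (x n) = y (n + d + c) - t (n + d) := by
      intro n
      induction n with
      | zero => simp [x, hw]
      | succ n ih =>
        have : x (n + 1) = x n + e n := by simp only [x, Finset.sum_range_succ, add_assoc]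
        rw [this, map_add, ih, hfe, map_sub, hw, hw]
        abel
    refine ⟨AdicCompletion.mk I M (AdicCompletion.AdicCauchySequence.mk I M x fun n => ?_), ?_⟩
    · rw [SModEq.comm, SModEq.sub_mem]
      have : x (n + 1) - x n = e n := by
        simp only [x, Finset.sum_range_succ, ← add_assoc, add_sub_cancel_left]
      rw [this]
      exact he n
    · rw [AdicCompletion.map_mk]
      refine AdicCompletion.ext fun n => (Submodule.Quotient.eq _).2 ?_
      change f (x n) - y n ∈ _
      rw [hx, sub_right_comm]
      exact sub_mem (hyn _ _ (by omega)) (hle _ _ (by omega) (ht _))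
  · rintro ⟨x, rfl⟩
    rw [AdicCompletion.map_comp_apply, h.linearMap_comp_eq_zero, AdicCompletion.map_zero]
    rfl

/-- If `f : M → N` has range the kernel of a linear map from `N` onto a flat module, then `f` is
strict for every adic topology. -/
theorem LinearMap.adicStrict_of_exact_of_flat {f : M →ₗ[R] N} {g : N →ₗ[R] P}
    (h : Function.Exact f g) (hg : Function.Surjective g) [Module.Flat R P] :
    f.AdicStrict I 0 := by
  intro n x hx
  rw [add_zero] at hx
  -- All of N serves as generating family, indexed by itself, so that `f x` becomes a finite sum of
  -- `a i • i` with coefficients in I^n.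
  have hspan : (⊤ : Submodule R N) = Submodule.span R (Set.range (fun i : N => i)) := by simp
  rw [hspan] at hx
  rw [Submodule.mem_ideal_smul_span_iff_exists_sum] at hx
  obtain ⟨a, ha, hax⟩ := hx
  have hrel : ∑ i : a.support, a i • g (i : N) = 0 := by
    rw [Finset.sum_coe_sort a.support (fun i : N => a i • g i), ← h.apply_apply_eq_zero x, ← hax,
      Finsupp.sum, map_sum]
    exact Finset.sum_congr rfl fun i _ => (map_smul g _ _).symm
  -- By the equational criterion the relation in P is trivial. Subtracting lifts of the trivializing
  -- elements moves each `i` into the range of `f`, and the subtracted terms cancel by `hb`.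
  obtain ⟨k, b, y, hy, hb⟩ := Module.Flat.isTrivialRelation_of_sum_smul_eq_zero hrel
  choose z hz using fun j => hg (y j)
  have hw : ∀ i : a.support, ∃ w, f w = (i : N) - ∑ j, b i j • z j := fun i => (h _).1 (by
    rw [map_sub, map_sum, sub_eq_zero]
    refine (hy i).trans (Finset.sum_congr rfl fun j _ => ?_)
    rw [map_smul, hz])
  choose w hw using hw
  refine ⟨∑ i : a.support, a i • w i,
    Submodule.sum_mem _ fun i _ => Submodule.smul_mem_smul (ha i) trivial, ?_⟩
  have h0 : ∑ i : a.support, a i • ∑ j, b i j • z j = 0 := by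
    simp_rw [Finset.smul_sum, smul_smul]
    rw [Finset.sum_comm]
    refine Finset.sum_eq_zero fun j _ => ?_
    rw [← Finset.sum_smul]
    exact (congrArg (fun r => r • z j) (hb j)).trans (zero_smul R _)
  rw [map_sum]
  simp_rw [map_smul, hw, smul_sub]
  rw [Finset.sum_sub_distrib, h0, sub_zero,
    Finset.sum_coe_sort a.support (fun i : N => a i • i), ← hax]
  rfl

/-! ### Flatness of completed projective modules -/

theorem AdicCompletion.map_sum_apply {κ : Type*} (s : Finset κ) (f : κ → M →ₗ[R] N)
    (x : AdicCompletion I M) :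
    AdicCompletion.map I (∑ i ∈ s, f i) x = ∑ i ∈ s, AdicCompletion.map I (f i) x := by
  classical
  induction x using AdicCompletion.induction_on with | _ x
  refine AdicCompletion.ext fun n => ?_
  rw [AdicCompletion.val_sum_apply]
  simp [AdicCompletion.map_mk]

theorem AdicCompletion.map_smul_apply (a : R) (f : M →ₗ[R] N) (x : AdicCompletion I M) :
    AdicCompletion.map I (a • f) x = a • AdicCompletion.map I f x := by
  induction x using AdicCompletion.induction_on with | _ x
  exact AdicCompletion.ext fun n => rfl

/-- By the equational criterion. The syzygies of the coefficients `f` are finitely generated, giving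
an exact sequence R^k → R^l → R. It stays exact after direct sums and completion, and the relation
`x` lifts to the completed R^k; the matrix of `b` trivializes it. -/
theorem AdicCompletion.flat_finsupp [IsNoetherianRing R] (ι : Type*) :
    Module.Flat R (AdicCompletion I (ι →₀ R)) := by
  refine Module.Flat.of_forall_isTrivialRelation fun {l f x} hx => ?_
  let g : (Fin l → R) →ₗ[R] R := ∑ i, f i • LinearMap.proj i
  obtain ⟨k, b, hb⟩ := Module.Finite.exists_fin' R (LinearMap.ker g)
  have hbg : Function.Exact ((LinearMap.ker g).subtype ∘ₗ b) g := fun y => by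
    constructor
    · intro hy
      obtain ⟨z, hz⟩ := hb ⟨y, hy⟩
      exact ⟨z, congrArg Subtype.val hz⟩
    · rintro ⟨z, rfl⟩
      exact (b z).2
  obtain ⟨c, hc⟩ := g.exists_adicStrict (I := I)
  obtain ⟨d, hd⟩ := ((LinearMap.ker g).subtype ∘ₗ b).exists_adicStrict (I := I)
  have hex := AdicCompletion.exact_map_of_adicStrict (Finsupp.exact_mapRange hbg ι)
    (hd.mapRange ι) (hc.mapRange ι)
  -- Coordinate inclusions and projections, which after completion pass between tuples in the
  -- completion of R^(ι) and elements of the completion of (R^n)^(ι).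
  let inc (n : ℕ) (i : Fin n) : (ι →₀ R) →ₗ[R] (ι →₀ (Fin n → R)) :=
    Finsupp.mapRange.linearMap (LinearMap.single R (fun _ => R) i)
  let pr (n : ℕ) (i : Fin n) : (ι →₀ (Fin n → R)) →ₗ[R] (ι →₀ R) :=
    Finsupp.mapRange.linearMap (LinearMap.proj i)
  have hpi : ∀ n (i j : Fin n), pr n i ∘ₗ inc n j = if i = j then LinearMap.id else 0 := by
    intro n i j
    refine Finsupp.lhom_ext fun s a => ?_
    ext t
    rcases eq_or_ne i j with rfl | hij
    · simp [pr, inc]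
    · simp [pr, inc, hij]
  obtain ⟨z, hz⟩ := (hex (∑ i, AdicCompletion.map I (inc l i) (x i))).1 (by
    rw [map_sum, ← hx]
    refine Finset.sum_congr rfl fun i _ => ?_
    rw [AdicCompletion.map_comp_apply]
    have : Finsupp.mapRange.linearMap g ∘ₗ inc l i = f i • LinearMap.id := by
      refine Finsupp.lhom_ext fun s a => ?_
      ext t
      rcases eq_or_ne s t with rfl | hst
      · simp [inc, g, Pi.single_apply]
      · simp [inc, hst]
    rw [this, AdicCompletion.map_smul_apply, AdicCompletion.map_id]
    rfl)
  refine ⟨k, fun i j => (b (Pi.single j 1) : Fin l → R) i,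
    fun j => AdicCompletion.map I (pr k j) z, fun i => ?_, fun j => ?_⟩
  · have h1 : x i = AdicCompletion.map I (pr l i)
        (∑ i, AdicCompletion.map I (inc l i) (x i)) := by
      rw [map_sum, Finset.sum_eq_single i]
      · rw [AdicCompletion.map_comp_apply, hpi, if_pos rfl, AdicCompletion.map_id]
        rfl
      · intro j _ hj
        rw [AdicCompletion.map_comp_apply, hpi, if_neg hj.symm, AdicCompletion.map_zero]
        rfl
      · simp
    rw [h1, ← hz, AdicCompletion.map_comp_apply]
    simp_rw [← AdicCompletion.map_smul_apply]
    rw [← AdicCompletion.map_sum_apply]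
    congr 2
    refine Finsupp.lhom_ext fun s v => ?_
    ext t
    rcases eq_or_ne s t with rfl | hst
    · simp only [pr, LinearMap.comp_apply, Finsupp.mapRange.linearMap_apply,
        Finsupp.mapRange_single, Finsupp.single_eq_same, LinearMap.proj_apply, LinearMap.sum_apply,
        LinearMap.smul_apply, Finsupp.finsetSum_apply, Finsupp.smul_apply]
      conv_lhs => rw [pi_eq_sum_univ' v]
      simp [mul_comm]
    · simp [pr, hst]
  · have := LinearMap.mem_ker.1 (b (Pi.single j 1)).2
    simpa only [g, LinearMap.sum_apply, LinearMap.smul_apply, LinearMap.proj_apply,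
      smul_eq_mul] using this

theorem AdicCompletion.flat_of_projective [IsNoetherianRing R] [Module.Projective R M] :
    Module.Flat R (AdicCompletion I M) := by
  obtain ⟨s, hs⟩ := Module.projective_def'.1 ‹Module.Projective R M›
  have := AdicCompletion.flat_finsupp (I := I) M
  refine Module.Flat.of_retract ((AdicCompletion.map I s).restrictScalars R)
    ((AdicCompletion.map I (Finsupp.linearCombination R id)).restrictScalars R) ?_
  refine LinearMap.ext fun x => ?_
  change AdicCompletion.map I _ (AdicCompletion.map I _ x) = x
  rw [AdicCompletion.map_comp_apply, hs, AdicCompletion.map_id]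
  rfl

end AdicExactness

/-! ### The zeroth left derived functor is right exact -/

namespace CategoryTheory

section

variable {C D : Type*} [Category* C] [Category* D] [Abelian C] [Abelian D]

namespace ProjectiveResolution

variable {X : C} (P : ProjectiveResolution X) (F : C ⥤ D) [F.Additive]

/-- The complex obtained by applying `F` to a projective resolution. -/
noncomputable abbrev mapComplex : ChainComplex D ℕ :=
  (F.mapHomologicalComplex (ComplexShape.down ℕ)).obj P.complex

/-- The augmentation of a projective resolution. -/
noncomputable def augmentation : P.complex.X 0 ⟶ X := P.π.f 0

/-- The canonical map from the value of `F` in degree zero to the opcycles. -/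
noncomputable def toOpcyclesZero : F.obj (P.complex.X 0) ⟶ (P.mapComplex F).opcycles 0 :=
  (P.mapComplex F).pOpcycles 0

instance : Epi (P.toOpcyclesZero F) :=
  inferInstanceAs (Epi ((P.mapComplex F).pOpcycles 0))

theorem toOpcyclesZero_comp_fromLeftDerivedZero' :
    P.toOpcyclesZero F ≫ P.fromLeftDerivedZero' F = F.map P.augmentation :=
  P.pOpcycles_comp_fromLeftDerivedZero' F

theorem d_comp_augmentation : P.complex.d 1 0 ≫ P.augmentation = 0 := P.complex_d_comp_π_f_zero

theorem exact_augmentation : (ShortComplex.mk _ _ P.d_comp_augmentation).Exact := P.exact₀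

instance : Epi P.augmentation := inferInstanceAs (Epi (P.π.f 0))

variable {F}

theorem toOpcyclesZero_opcyclesMap {Y : C} {Q : ProjectiveResolution Y}
    (φ : P.complex ⟶ Q.complex) :
    P.toOpcyclesZero F ≫ HomologicalComplex.opcyclesMap ((F.mapHomologicalComplex _).map φ) 0 =
      F.map (φ.f 0) ≫ Q.toOpcyclesZero F :=
  HomologicalComplex.p_opcyclesMap _ _

theorem toOpcyclesZero_opcyclesMap_app {G : C ⥤ D} [G.Additive] (α : F ⟶ G) :
    P.toOpcyclesZero F ≫ HomologicalComplex.opcyclesMap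
        ((NatTrans.mapHomologicalComplex α (ComplexShape.down ℕ)).app P.complex) 0 =
      α.app _ ≫ P.toOpcyclesZero G :=
  HomologicalComplex.p_opcyclesMap _ _

variable (F) [HasProjectiveResolutions C]

/-- The zeroth left derived functor as homology of the complex `P.mapComplex F`. -/
noncomputable def leftDerivedZeroIsoHomology :
    (F.leftDerived 0).obj X ≅ (P.mapComplex F).homology 0 :=
  P.isoLeftDerivedObj F 0

/-- The zeroth left derived functor as opcycles of the complex `P.mapComplex F`. -/
noncomputable def leftDerivedZeroIsoOpcycles :
    (F.leftDerived 0).obj X ≅ (P.mapComplex F).opcycles 0 :=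
  P.leftDerivedZeroIsoHomology F ≪≫ ChainComplex.isoHomologyι₀ _

theorem fromLeftDerivedZero_eq_opcycles :
    F.fromLeftDerivedZero.app X =
      (P.leftDerivedZeroIsoOpcycles F).hom ≫ P.fromLeftDerivedZero' F :=
  (P.fromLeftDerivedZero_eq F).trans (Category.assoc _ _ _).symm

variable {F}

theorem leftDerived_app_comp_opcycles {G : C ⥤ D} [G.Additive] (α : F ⟶ G) :
    (NatTrans.leftDerived α 0).app X ≫ (P.leftDerivedZeroIsoOpcycles G).hom =
      (P.leftDerivedZeroIsoOpcycles F).hom ≫ HomologicalComplex.opcyclesMap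
        ((NatTrans.mapHomologicalComplex α (ComplexShape.down ℕ)).app P.complex) 0 := by
  have h : (NatTrans.leftDerived α 0).app X = (P.leftDerivedZeroIsoHomology F).hom ≫
      HomologicalComplex.homologyMap
        ((NatTrans.mapHomologicalComplex α (ComplexShape.down ℕ)).app P.complex) 0 ≫
      (P.leftDerivedZeroIsoHomology G).inv := P.leftDerived_app_eq α 0
  rw [h]
  simp [leftDerivedZeroIsoOpcycles, ChainComplex.isoHomologyι₀]

theorem leftDerived_map_comp_opcycles {Y : C} {Q : ProjectiveResolution Y} (f : X ⟶ Y)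
    (φ : P.complex ⟶ Q.complex) (w : φ.f 0 ≫ Q.augmentation = P.augmentation ≫ f) :
    (F.leftDerived 0).map f ≫ (Q.leftDerivedZeroIsoOpcycles F).hom =
      (P.leftDerivedZeroIsoOpcycles F).hom ≫
        HomologicalComplex.opcyclesMap ((F.mapHomologicalComplex _).map φ) 0 := by
  have h : (F.leftDerived 0).map f ≫ (Q.leftDerivedZeroIsoHomology F).hom =
      (P.leftDerivedZeroIsoHomology F).hom ≫
        HomologicalComplex.homologyMap ((F.mapHomologicalComplex _).map φ) 0 :=
    isoLeftDerivedObj_hom_naturality f P Q φ w F 0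
  unfold leftDerivedZeroIsoOpcycles
  rw [Iso.trans_hom, reassoc_of% h]
  simp [ChainComplex.isoHomologyι₀]

variable (F)

/-- The term P_0 is its own projective resolution, concentrated in degree zero. The chain map to P
over the augmentation is the identity in degree zero, so it induces the projection to opcycles. -/
theorem leftDerived_map_augmentation :
    (F.leftDerived 0).map P.augmentation ≫ (P.leftDerivedZeroIsoOpcycles F).hom =
      F.fromLeftDerivedZero.app (P.complex.X 0) ≫ P.toOpcyclesZero F := by
  have := P.projective 0
  let Q := ProjectiveResolution.self (P.complex.X 0)
  let φ : Q.complex ⟶ P.complex := (P.complex.fromSingle₀Equiv (P.complex.X 0)).symm (𝟙 _)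
  have hφ : φ.f 0 = 𝟙 (P.complex.X 0) :=
    ChainComplex.fromSingle₀Equiv_symm_apply_f_zero (C := P.complex) (𝟙 (P.complex.X 0))
  have hQ : Q.augmentation = 𝟙 (P.complex.X 0) := rfl
  rw [Q.leftDerived_map_comp_opcycles (Q := P) P.augmentation φ
    (congrArg₂ (fun a b => a ≫ b) (hφ.trans hQ.symm) rfl), Q.fromLeftDerivedZero_eq_opcycles F,
    Category.assoc]
  congr 1
  rw [← cancel_epi (Q.toOpcyclesZero F), toOpcyclesZero_opcyclesMap, ← Category.assoc,
    toOpcyclesZero_comp_fromLeftDerivedZero']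
  exact congrArg (fun a => F.map a ≫ P.toOpcyclesZero F) (hφ.trans hQ.symm)

instance isIso_fromLeftDerivedZero_X (n : ℕ) :
    IsIso (F.fromLeftDerivedZero.app (P.complex.X n)) :=
  have := P.projective n
  inferInstance

instance epi_leftDerived_map_augmentation : Epi ((F.leftDerived 0).map P.augmentation) := by
  have : Epi ((F.leftDerived 0).map P.augmentation ≫ (P.leftDerivedZeroIsoOpcycles F).hom) := by
    rw [leftDerived_map_augmentation]
    infer_instance
  exact (epi_comp_iff_of_isIso _ (P.leftDerivedZeroIsoOpcycles F).hom).1 this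

/-- The opcycles in degree zero are the cokernel of F(P_1) → F(P_0), and F agrees with its zeroth
derived functor on the projectives P_1 and P_0. -/
theorem exact_leftDerived_map (w : (F.leftDerived 0).map (P.complex.d 1 0) ≫
      (F.leftDerived 0).map P.augmentation = 0) :
    (ShortComplex.mk _ _ w).Exact := by
  have hw : F.map (P.complex.d 1 0) ≫ P.toOpcyclesZero F = 0 :=
    (P.mapComplex F).d_pOpcycles 1 0
  have hK : (ShortComplex.mk (F.map (P.complex.d 1 0)) (P.toOpcyclesZero F) hw).Exact :=
    ShortComplex.exact_of_g_is_cokernel _ ((P.mapComplex F).opcyclesIsCokernel 1 0 (by simp))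
  refine (ShortComplex.exact_iff_of_iso (ShortComplex.isoMk
    (asIso (F.fromLeftDerivedZero.app (P.complex.X 1)))
    (asIso (F.fromLeftDerivedZero.app (P.complex.X 0)))
    (P.leftDerivedZeroIsoOpcycles F) ?_ ?_)).2 hK
  · exact (F.fromLeftDerivedZero.naturality (P.complex.d 1 0)).symm
  · exact (P.leftDerived_map_augmentation F).symm

end ProjectiveResolution

theorem NatTrans.leftDerived_comp_fromLeftDerivedZero [HasProjectiveResolutions C]
    {F G : C ⥤ D} [F.Additive] [G.Additive]
    (α : F ⟶ G) (X : C) :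
    (NatTrans.leftDerived α 0).app X ≫ G.fromLeftDerivedZero.app X =
      F.fromLeftDerivedZero.app X ≫ α.app X := by
  let P := projectiveResolution X
  rw [P.fromLeftDerivedZero_eq_opcycles, P.fromLeftDerivedZero_eq_opcycles, ← Category.assoc,
    P.leftDerived_app_comp_opcycles, Category.assoc, Category.assoc]
  congr 1
  rw [← cancel_epi (P.toOpcyclesZero F), ← Category.assoc, P.toOpcyclesZero_opcyclesMap_app,
    Category.assoc, P.toOpcyclesZero_comp_fromLeftDerivedZero', ← Category.assoc,
    P.toOpcyclesZero_comp_fromLeftDerivedZero', α.naturality]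

end

end CategoryTheory

/-! ### Right exactness deduced from preserved projective presentations -/

namespace ModuleCat

section

variable {A B : Type u} [CommRing A] [CommRing B]

/-- In a map of right exact sequences whose first two components are isomorphisms, the third one
is an isomorphism. -/
theorem isIso_of_right_exact {X Y Z X' Y' Z' : ModuleCat.{u} A} {f : X ⟶ Y} {g : Y ⟶ Z}
    {f' : X' ⟶ Y'} {g' : Y' ⟶ Z'} (a : X ⟶ X') (b : Y ⟶ Y') (c : Z ⟶ Z')
    (hab : f ≫ b = a ≫ f') (hbc : g ≫ c = b ≫ g')
    (h : Function.Exact f.hom g.hom) (hg : Function.Surjective g.hom)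
    (h' : Function.Exact f'.hom g'.hom) (hg' : Function.Surjective g'.hom)
    [IsIso a] [IsIso b] : IsIso c := by
  rw [ConcreteCategory.isIso_iff_bijective]
  have hA : Function.Bijective a.hom := ConcreteCategory.bijective_of_isIso a
  have hB : Function.Bijective b.hom := ConcreteCategory.bijective_of_isIso b
  have hab' : ∀ x, b.hom (f.hom x) = f'.hom (a.hom x) := fun x => ConcreteCategory.congr_hom hab x
  have hbc' : ∀ y, c.hom (g.hom y) = g'.hom (b.hom y) := fun y => ConcreteCategory.congr_hom hbc y
  constructor
  · refine (injective_iff_map_eq_zero c.hom).2 fun z hz => ?_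
    obtain ⟨y, rfl⟩ := hg z
    rw [hbc'] at hz
    obtain ⟨x', hx'⟩ := (h' _).1 hz
    obtain ⟨x, rfl⟩ := hA.2 x'
    rw [← hab'] at hx'
    rw [← hB.1 hx', h.apply_apply_eq_zero]
  · intro z'
    obtain ⟨y', rfl⟩ := hg' z'
    obtain ⟨y, rfl⟩ := hB.2 y'
    exact ⟨g.hom y, hbc' y⟩

variable (G : ModuleCat.{u} A ⥤ ModuleCat.{u} B)

/-- A projective presentation of a module that is preserved by the functor `G`. -/
structure PreservedPresentation (Z : ModuleCat.{u} A) where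
  /-- the relations -/
  rel : ModuleCat.{u} A
  /-- the generators -/
  gen : ModuleCat.{u} A
  /-- the map from relations to generators -/
  d : rel ⟶ gen
  /-- the map from the generators onto the module -/
  π : gen ⟶ Z
  projective_rel : Projective rel
  projective_gen : Projective gen
  exact : Function.Exact d.hom π.hom
  surjective : Function.Surjective π.hom
  map_exact : Function.Exact (G.map d).hom (G.map π).hom
  map_surjective : Function.Surjective (G.map π).hom

variable {G}

theorem exists_lift {P X Y Z : ModuleCat.{u} A} [Projective P] {f : X ⟶ Y} {g : Y ⟶ Z}
    (h : Function.Exact f.hom g.hom) (k : P ⟶ Y) (hk : k ≫ g = 0) : ∃ l : P ⟶ X, l ≫ f = k := by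
  have w : f ≫ g = 0 := ModuleCat.hom_ext h.linearMap_comp_eq_zero
  have hS : (ShortComplex.mk f g w).Exact :=
    (ShortComplex.ShortExact.moduleCat_exact_iff_function_exact _).2 h
  exact ⟨hS.liftFromProjective k hk, hS.liftFromProjective_comp k hk⟩

theorem map_surjective_of_presentation (hG : ∀ Z, Nonempty (PreservedPresentation G Z))
    {Y Z : ModuleCat.{u} A} {g : Y ⟶ Z} (hg : Function.Surjective g.hom) :
    Function.Surjective (G.map g).hom := by
  obtain ⟨P⟩ := hG Z
  have := P.projective_gen
  have := (ModuleCat.epi_iff_surjective g).2 hg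
  intro z
  obtain ⟨p, rfl⟩ := P.map_surjective z
  refine ⟨(G.map (Projective.factorThru P.π g)).hom p, ?_⟩
  rw [← LinearMap.comp_apply, ← ModuleCat.hom_comp, ← G.map_comp, Projective.factorThru_comp]

/-- Exactness on one presentation of `Z` spreads to all right exact sequences ending in `Z`, by
comparing generators of `Y` and of `Z` through lifts of maps out of projectives. -/
theorem map_exact_of_presentation [G.Additive] (hG : ∀ Z, Nonempty (PreservedPresentation G Z))
    {X Y Z : ModuleCat.{u} A} {f : X ⟶ Y} {g : Y ⟶ Z}
    (h : Function.Exact f.hom g.hom) (hg : Function.Surjective g.hom) :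
    Function.Exact (G.map f).hom (G.map g).hom := by
  have w : f ≫ g = 0 := ModuleCat.hom_ext h.linearMap_comp_eq_zero
  have key : ∀ {U V W : ModuleCat.{u} A} (a : U ⟶ V) (b : V ⟶ W) (x : G.obj U),
      (G.map b).hom ((G.map a).hom x) = (G.map (a ≫ b)).hom x := fun a b x => by
    rw [G.map_comp]; rfl
  intro y
  constructor
  · intro hy
    obtain ⟨P⟩ := hG Z
    obtain ⟨Q⟩ := hG Y
    have := P.projective_gen
    have := P.projective_rel
    have := Q.projective_gen
    have := (ModuleCat.epi_iff_surjective g).2 hg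
    have := (ModuleCat.epi_iff_surjective P.π).2 P.surjective
    obtain ⟨q, rfl⟩ := Q.map_surjective y
    let s : P.gen ⟶ Y := Projective.factorThru P.π g
    have hs : s ≫ g = P.π := Projective.factorThru_comp _ _
    let r : Q.gen ⟶ P.gen := Projective.factorThru (Q.π ≫ g) P.π
    have hr : r ≫ P.π = Q.π ≫ g := Projective.factorThru_comp _ _
    -- Generators of `Y` are split as `Q.π = r ≫ s + t ≫ f`, and relations of `Z` satisfy `P.d ≫ s =
    -- v ≫ f`. If `y` dies in G Z, then G(r) q comes from a relation `x`, so both summands of `y`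
    -- come from G X.
    obtain ⟨t, ht⟩ := exists_lift h (Q.π - r ≫ s) (by
      rw [Preadditive.sub_comp, Category.assoc, hs, hr, sub_self])
    have hdπ : P.d ≫ P.π = 0 := ModuleCat.hom_ext P.exact.linearMap_comp_eq_zero
    obtain ⟨v, hv⟩ := exists_lift h (P.d ≫ s) (by rw [Category.assoc, hs, hdπ])
    rw [key, ← hr, ← key] at hy
    obtain ⟨x, hx⟩ := (P.map_exact _).1 hy
    refine ⟨(G.map v).hom x + (G.map t).hom q, ?_⟩
    rw [map_add, key, key, ht, hv, ← key, hx, key, ← LinearMap.add_apply, ← ModuleCat.hom_add,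
      ← G.map_add, add_sub_cancel]
  · rintro ⟨x, rfl⟩
    rw [key, w, G.map_zero]
    rfl

theorem nonempty_preservedPresentation_leftDerived (F : ModuleCat.{u} A ⥤ ModuleCat.{u} B)
    [F.Additive] (hF : (F.leftDerived 0).Additive) (Z : ModuleCat.{u} A) :
    Nonempty (PreservedPresentation (F.leftDerived 0) Z) := by
  let P := CategoryTheory.projectiveResolution Z
  have w : (F.leftDerived 0).map (P.complex.d 1 0) ≫ (F.leftDerived 0).map P.augmentation = 0 := by
    rw [← Functor.map_comp, P.d_comp_augmentation, Functor.map_zero]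
  exact ⟨{
    rel := P.complex.X 1
    gen := P.complex.X 0
    d := P.complex.d 1 0
    π := P.augmentation
    projective_rel := P.projective 1
    projective_gen := P.projective 0
    exact := (ShortComplex.ShortExact.moduleCat_exact_iff_function_exact _).1
      P.exact_augmentation
    surjective := (ModuleCat.epi_iff_surjective _).1 inferInstance
    map_exact := (ShortComplex.ShortExact.moduleCat_exact_iff_function_exact _).1
      (P.exact_leftDerived_map F w)
    map_surjective := (ModuleCat.epi_iff_surjective _).1
      (P.epi_leftDerived_map_augmentation F) }⟩

end

end ModuleCat

/-! ### Comparison of L_0 with adic completion -/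

section LCompletion

variable {A : Type u} [CommRing A] (I : Ideal A)

/-- The natural map `Â ⊗_A M → L_0 M`. -/
noncomputable def extToL0 :
    ModuleCat.extendScalars.{u, u, u} (algebraMap A (AdicCompletion I A)) ⟶ L0 I :=
  (ModuleCat.extendScalars (algebraMap A (AdicCompletion I A))).leftDerivedZeroIsoSelf.inv ≫
    NatTrans.leftDerived (extToAdic I) 0

theorem extToL0_comp_L0ToAdic (M : ModuleCat.{u} A) :
    (extToL0 I).app M ≫ (L0ToAdic I).app M = (extToAdic I).app M := by
  let E := ModuleCat.extendScalars.{u, u, u} (algebraMap A (AdicCompletion I A))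
  refine (Category.assoc (E.leftDerivedZeroIsoSelf.inv.app M) _ _).trans ?_
  refine (congrArg (fun k => E.leftDerivedZeroIsoSelf.inv.app M ≫ k)
    (NatTrans.leftDerived_comp_fromLeftDerivedZero (extToAdic I) M)).trans ?_
  refine (Category.assoc _ _ _).symm.trans ?_
  exact (congrArg (fun k => k ≫ (extToAdic I).app M)
    (E.leftDerivedZeroIsoSelf_inv_hom_id_app M)).trans (Category.id_comp _)

theorem lUnit_app (M : ModuleCat.{u} A) :
    (lUnit I).app M =
      (ModuleCat.extendRestrictScalarsAdj (algebraMap A (AdicCompletion I A))).unit.app M ≫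
        (res I).map ((extToL0 I).app M) := rfl

theorem lUnit_comp_L0ToAdic (M : ModuleCat.{u} A) :
    (lUnit I).app M ≫ (res I).map ((L0ToAdic I).app M) = (adicUnit I).app M := by
  let adj := ModuleCat.extendRestrictScalarsAdj (algebraMap A (AdicCompletion I A))
  have h : (extToAdic I).app M = (adj.homEquiv _ _).symm ((adicUnit I).app M) :=
    (adj.homEquiv_counit _ _ _).symm
  rw [lUnit_app, Category.assoc, ← Functor.map_comp, extToL0_comp_L0ToAdic, h]
  exact (adj.homEquiv_unit _ _ _).symm.trans (Equiv.apply_symm_apply _ _)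

theorem L0_map_surjective {M N : ModuleCat.{u} A} {f : M ⟶ N}
    (hf : Function.Surjective f.hom) : Function.Surjective ((L0 I).map f).hom :=
  ModuleCat.map_surjective_of_presentation
    (ModuleCat.nonempty_preservedPresentation_leftDerived (adicFunctor I)
      (inferInstanceAs (L0 I).Additive)) hf

theorem L0_map_exact {M N P : ModuleCat.{u} A} {f : M ⟶ N} {g : N ⟶ P}
    (h : Function.Exact f.hom g.hom) (hg : Function.Surjective g.hom) :
    Function.Exact ((L0 I).map f).hom ((L0 I).map g).hom :=
  ModuleCat.map_exact_of_presentation (G := L0 I)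
    (ModuleCat.nonempty_preservedPresentation_leftDerived (adicFunctor I)
      (inferInstanceAs (L0 I).Additive)) h hg

theorem isIso_L0ToAdic_of_projective (P : ModuleCat.{u} A) [Projective P] :
    IsIso ((L0ToAdic I).app P) :=
  inferInstanceAs (IsIso ((adicFunctor I).fromLeftDerivedZero.app P))

/-- L_0 and completion agree on projectives, so it suffices that both are right exact on a
presentation of `M`. For completion this holds because flatness of `M` makes the map from relations
to generators strict. -/
theorem isIso_L0ToAdic_of_flat (M : ModuleCat.{u} A) [Module.Flat A M] :
    IsIso ((L0ToAdic I).app M) := by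
  obtain ⟨P⟩ := ModuleCat.nonempty_preservedPresentation_leftDerived (adicFunctor I)
      (inferInstanceAs (L0 I).Additive) M
  have := P.projective_gen
  have := P.projective_rel
  have := isIso_L0ToAdic_of_projective I P.rel
  have := isIso_L0ToAdic_of_projective I P.gen
  exact ModuleCat.isIso_of_right_exact (f' := (adicFunctor I).map P.d)
    (g' := (adicFunctor I).map P.π) ((L0ToAdic I).app P.rel) ((L0ToAdic I).app P.gen) _
    ((L0ToAdic I).naturality P.d) ((L0ToAdic I).naturality P.π) P.map_exact P.map_surjective
    (AdicCompletion.exact_map_of_adicStrict P.exact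
      (LinearMap.adicStrict_of_exact_of_flat P.exact P.surjective)
      (LinearMap.adicStrict_of_surjective P.surjective))
    (AdicCompletion.map_surjective I P.surjective)

/-- The `I`-adic completion of `M`, as an `A`-module by restriction of scalars along `A → Â`. -/
noncomputable def adicResEquiv (M : ModuleCat.{u} A) :
    AdicCompletion I M ≃ₗ[A] (res I).obj ((adicFunctor I).obj M) where
  toFun x := x
  invFun x := x
  left_inv _ := rfl
  right_inv _ := rfl
  map_add' _ _ := rfl
  map_smul' a x := (algebraMap_smul (AdicCompletion I A) a x).symm

variable {I}

theorem isIso_lUnit_of_flat_of_isAdicComplete (M : ModuleCat.{u} A) [Module.Flat A M]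
    [IsAdicComplete I M] : IsIso ((lUnit I).app M) := by
  have h := lUnit_comp_L0ToAdic I M
  have := isIso_L0ToAdic_of_flat I M
  have : IsIso ((adicUnit I).app M) := by
    rw [ConcreteCategory.isIso_iff_bijective]
    exact AdicCompletion.of_bijective I M
  rw [← h] at this
  exact IsIso.of_isIso_comp_right _ ((res I).map ((L0ToAdic I).app M))

theorem isAdicComplete_of_linearEquiv {M N : Type*} [AddCommGroup M] [Module A M]
    [AddCommGroup N] [Module A N] (e : M ≃ₗ[A] N) [IsAdicComplete I M] : IsAdicComplete I N := by
  rw [← AdicCompletion.of_bijective_iff]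
  have h : ⇑(AdicCompletion.of I N) =
      AdicCompletion.congr I e ∘ AdicCompletion.of I M ∘ e.symm := by
    ext x
    simp
  rw [h]
  exact (AdicCompletion.congr I e).bijective.comp
    ((AdicCompletion.of_bijective I M).comp e.symm.bijective)

/-- For finitely generated I, I^n times the completion is the kernel of evaluation at level n; both
sides therefore need only be compared at that level. -/
theorem AdicCompletion.map_of_apply (hI : I.FG) {M : Type*} [AddCommGroup M] [Module A M]
    (x : AdicCompletion I M) :
    AdicCompletion.map I (AdicCompletion.of I M) x =
      AdicCompletion.of I (AdicCompletion I M) x := by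
  induction x using AdicCompletion.induction_on with | _ a
  refine AdicCompletion.ext fun n => (Submodule.Quotient.eq _).2 ?_
  rw [AdicCompletion.pow_smul_top_eq_ker_eval hI, LinearMap.mem_ker, map_sub, sub_eq_zero]
  rfl

/-! ### Idempotence of L-completion -/

variable (I) [IsNoetherianRing A]

theorem isIso_lUnit_adic (P : ModuleCat.{u} A) [Projective P] :
    IsIso ((lUnit I).app ((res I).obj ((adicFunctor I).obj P))) := by
  have : Module.Projective A P := (IsProjective.iff_projective P).2 ‹_›
  have : Module.Flat A (AdicCompletion I P) := AdicCompletion.flat_of_projective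
  have := AdicCompletion.isAdicComplete (M := P) (IsNoetherian.noetherian I)
  have := Module.Flat.of_linearEquiv (adicResEquiv I P).symm
  have := isAdicComplete_of_linearEquiv (I := I) (adicResEquiv I P)
  exact isIso_lUnit_of_flat_of_isAdicComplete _

theorem isIso_lUnit_L0_of_projective (P : ModuleCat.{u} A) [Projective P] :
    IsIso ((lUnit I).app ((res I).obj ((L0 I).obj P))) := by
  have := isIso_L0ToAdic_of_projective I P
  have := isIso_lUnit_adic I P
  exact ((lUnit I).isIso_app_iff_of_iso ((res I).mapIso (asIso ((L0ToAdic I).app P)))).2 this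

/-- The `L`-completion of a module is `L`-complete. -/
theorem isIso_lUnit_L0 (M : ModuleCat.{u} A) :
    IsIso ((lUnit I).app ((res I).obj ((L0 I).obj M))) := by
  obtain ⟨P⟩ := ModuleCat.nonempty_preservedPresentation_leftDerived (adicFunctor I)
      (inferInstanceAs (L0 I).Additive) M
  have := P.projective_gen
  have := P.projective_rel
  have := isIso_lUnit_L0_of_projective I P.rel
  have := isIso_lUnit_L0_of_projective I P.gen
  have hex : Function.Exact ((res I).map ((L0 I).map P.d)).hom
    ((res I).map ((L0 I).map P.π)).hom := P.map_exact
  have hs : Function.Surjective ((res I).map ((L0 I).map P.π)).hom := P.map_surjective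
  exact ModuleCat.isIso_of_right_exact
    ((lUnit I).app ((res I).obj ((L0 I).obj P.rel)))
    ((lUnit I).app ((res I).obj ((L0 I).obj P.gen))) _
    ((lUnit I).naturality ((res I).map ((L0 I).map P.d)))
    ((lUnit I).naturality ((res I).map ((L0 I).map P.π))) hex hs
    (L0_map_exact I hex hs) (L0_map_surjective I hs)

theorem adicFunctor_map_adicUnit_surjective (M : ModuleCat.{u} A) :
    Function.Surjective ((adicFunctor I).map ((adicUnit I).app M)).hom := by
  have hI : I.FG := IsNoetherian.noetherian I
  have := AdicCompletion.isAdicComplete (M := M) hI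
  intro z
  obtain ⟨y, hy⟩ := (AdicCompletion.congr I (adicResEquiv I M)).surjective z
  obtain ⟨x, rfl⟩ := AdicCompletion.of_surjective I _ y
  refine ⟨x, ?_⟩
  rw [← hy, ← AdicCompletion.map_of_apply hI]
  exact (AdicCompletion.map_comp_apply I (AdicCompletion.of I M)
    (adicResEquiv I M).toLinearMap x).symm

/-- `P` and its completion are flat, so L_0 may be replaced by completion on both. This turns L_0(η)
into the completion of the map from `P` to its completion, which is surjective. -/
theorem L0_map_lUnit_surjective_of_projective (P : ModuleCat.{u} A) [Projective P] :
    Function.Surjective ((L0 I).map ((lUnit I).app P)).hom := by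
  let T := (res I).obj ((adicFunctor I).obj P)
  have : Module.Projective A P := (IsProjective.iff_projective P).2 ‹_›
  have : Module.Flat A (AdicCompletion I P) := AdicCompletion.flat_of_projective
  have : Module.Flat A T := Module.Flat.of_linearEquiv (adicResEquiv I P).symm
  have := isIso_L0ToAdic_of_flat I T
  have := isIso_L0ToAdic_of_projective I P
  have h : (L0 I).map ((lUnit I).app P) ≫ (L0 I).map ((res I).map ((L0ToAdic I).app P)) ≫
      (L0ToAdic I).app T =
        (L0ToAdic I).app P ≫ (adicFunctor I).map ((adicUnit I).app P) := by
    rw [← (L0 I).map_comp_assoc, lUnit_comp_L0ToAdic]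
    exact (L0ToAdic I).naturality ((adicUnit I).app P)
  have h3 : Epi ((L0 I).map ((lUnit I).app P) ≫
      (L0 I).map ((res I).map ((L0ToAdic I).app P)) ≫ (L0ToAdic I).app T) := by
    rw [h]
    exact epi_comp' (IsIso.epi_of_iso ((L0ToAdic I).app P))
      ((ModuleCat.epi_iff_surjective _).2 (adicFunctor_map_adicUnit_surjective I P))
  have h4 : IsIso ((L0 I).map ((res I).map ((L0ToAdic I).app P)) ≫ (L0ToAdic I).app T) :=
    IsIso.comp_isIso' inferInstance ‹_›
  exact (ModuleCat.epi_iff_surjective _).1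
    ((epi_comp_iff_of_isIso ((L0 I).map ((lUnit I).app P)) _).1 h3)

theorem L0_map_lUnit_surjective (M : ModuleCat.{u} A) :
    Function.Surjective ((L0 I).map ((lUnit I).app M)).hom := by
  let π := Projective.π M
  have hπ : Function.Surjective π.hom := (ModuleCat.epi_iff_surjective _).1 inferInstance
  have h : (L0 I).map ((lUnit I).app (Projective.over M)) ≫
      (L0 I).map ((res I).map ((L0 I).map π)) = (L0 I).map π ≫ (L0 I).map ((lUnit I).app M) := by
    rw [← Functor.map_comp, ← Functor.map_comp]
    exact congrArg (L0 I).map ((lUnit I).naturality π).symm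
  have hs : Function.Surjective ((res I).map ((L0 I).map π)).hom := L0_map_surjective I hπ
  have h1 := (L0_map_surjective I hs).comp
    (L0_map_lUnit_surjective_of_projective I (Projective.over M))
  have h2 : Function.Surjective (((L0 I).map ((lUnit I).app (Projective.over M)) ≫
      (L0 I).map ((res I).map ((L0 I).map π))).hom) := h1
  rw [h] at h2
  exact Function.Surjective.of_comp h2

variable {I}

/-- Two `A`-linear maps from `L_0 M` to an `L`-complete module agree if they agree on `M`. -/
theorem lUnit_hom_ext {M T : ModuleCat.{u} A} [IsIso ((lUnit I).app T)]
    {f g : (res I).obj ((L0 I).obj M) ⟶ T}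
    (h : (lUnit I).app M ≫ f = (lUnit I).app M ≫ g) : f = g := by
  have : Epi ((L0 I).map ((lUnit I).app M)) :=
    (ModuleCat.epi_iff_surjective _).2 (L0_map_lUnit_surjective I M)
  -- L_0(η) is epi, so L_0(f) = L_0(g); naturality of η and its injectivity on `T` bring this back
  -- to f = g.
  have h' : (L0 I).map f = (L0 I).map g := by
    refine (cancel_epi ((L0 I).map ((lUnit I).app M))).1 ?_
    exact ((L0 I).map_comp _ _).symm.trans ((congrArg (L0 I).map h).trans ((L0 I).map_comp _ _))
  have : Mono ((lUnit I).app T) := IsIso.mono_of_iso _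
  refine (cancel_mono ((lUnit I).app T)).1 ?_
  have hn := fun k : (res I).obj ((L0 I).obj M) ⟶ T => (lUnit I).naturality k
  simp only [Functor.id_map, Functor.comp_map] at hn
  rw [hn f, hn g, h']

/-- By naturality the two maps agree after precomposition with η, and their target is L-complete.
This converts the L_0(η) arising from functoriality into the η in the definition of `IsLComplete`.
-/
theorem res_map_L0_map_lUnit (M : ModuleCat.{u} A) :
    (res I).map ((L0 I).map ((lUnit I).app M)) =
      (lUnit I).app ((res I).obj ((L0 I).obj M)) := by
  have : IsIso ((lUnit I).app ((res I).obj ((L0 I).obj ((L0 I ⋙ res I).obj M)))) :=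
    isIso_lUnit_L0 I ((res I).obj ((L0 I).obj M))
  exact lUnit_hom_ext ((lUnit I).naturality ((lUnit I).app M)).symm

/-- Two `A`-linear maps from `Â` to an `L`-complete module agree if they agree on `A`. -/
theorem adicUnit_hom_ext {T : ModuleCat.{u} A} [IsIso ((lUnit I).app T)]
    {f g : (res I).obj ((adicFunctor I).obj (ModuleCat.of A A)) ⟶ T}
    (h : (adicUnit I).app (ModuleCat.of A A) ≫ f = (adicUnit I).app (ModuleCat.of A A) ≫ g) :
    f = g := by
  have : Projective (ModuleCat.of A A) :=
    (IsProjective.iff_projective _).1 (inferInstanceAs (Module.Projective A A))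
  have := isIso_L0ToAdic_of_projective I (ModuleCat.of A A)
  have : Epi ((res I).map ((L0ToAdic I).app (ModuleCat.of A A))) := IsIso.epi_of_iso _
  refine (cancel_epi ((res I).map ((L0ToAdic I).app (ModuleCat.of A A)))).1 (lUnit_hom_ext ?_)
  rw [← Category.assoc, ← Category.assoc, lUnit_comp_L0ToAdic]
  exact h

/-- An `A`-linear map from an `Â`-module to an `L`-complete `Â`-module is `Â`-linear. -/
theorem exists_res_map_eq {M N : ModuleCat.{u} (AdicCompletion I A)}
    [IsIso ((lUnit I).app ((res I).obj N))] (f : (res I).obj M ⟶ (res I).obj N) :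
    ∃ F : M ⟶ N, (res I).map F = f := by
  have h : ∀ (x : AdicCompletion I A) (m : M), f.hom (x • m) = x • (f.hom m : N) := by
    intro x m
    -- For fixed `m`, the maps x ↦ f(xm) and x ↦ x f(m) out of Â agree on A, hence everywhere.
    have : (res I).map (hatToSpanSingleton I M m) ≫ f =
        (res I).map (hatToSpanSingleton I N (f.hom m)) := by
      refine adicUnit_hom_ext (ModuleCat.hom_ext (LinearMap.ext fun a : A => ?_))
      exact f.hom.map_smul a m
    exact ConcreteCategory.congr_hom this x
  exact ⟨ModuleCat.ofHom
    { toFun := fun m => f.hom m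
      map_add' := f.hom.map_add
      map_smul' := h }, rfl⟩

/-- The universal property of `η : M → L_0 M`. -/
theorem existsUnique_lUnit_comp_eq {M : ModuleCat.{u} A} {N : ModuleCat.{u} (AdicCompletion I A)}
    [IsIso ((lUnit I).app ((res I).obj N))] (f : M ⟶ (res I).obj N) :
    ∃! F : (L0 I).obj M ⟶ N, (lUnit I).app M ≫ (res I).map F = f := by
  -- The inverse of η on `N` is a priori only `A`-linear, hence the passage through
  -- `exists_res_map_eq`.
  obtain ⟨F, hF⟩ := exists_res_map_eq
    ((res I).map ((L0 I).map f) ≫ inv ((lUnit I).app ((res I).obj N)))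
  refine ⟨F, ?_, fun F' hF' => ?_⟩
  · have hn := (lUnit I).naturality f
    simp only [Functor.id_map, Functor.comp_map] at hn
    refine (congrArg (fun k => (lUnit I).app M ≫ k) hF).trans ?_
    exact (Category.assoc _ _ _).symm.trans ((IsIso.comp_inv_eq _).2 hn.symm)
  · refine (res I).map_injective (lUnit_hom_ext (hF'.trans ?_))
    have hn := (lUnit I).naturality f
    simp only [Functor.id_map, Functor.comp_map] at hn
    refine Eq.symm ((congrArg (fun k => (lUnit I).app M ≫ k) hF).trans ?_)
    exact (Category.assoc _ _ _).symm.trans ((IsIso.comp_inv_eq _).2 hn.symm)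

end LCompletion

/-! ### The L-complete comodule L_0 M -/

namespace HopfAlgebroid

variable {A Ψ : Type u} [CommRing A] [CommRing Ψ] (H : HopfAlgebroid A Ψ) (I : Ideal A)

theorem lUnit_comp_hatCounit :
    (lUnit I).app H.biMod.left ≫ (res I).map (H.hatCounit I) =
      H.counitHom ≫ (adicUnit I).app (ModuleCat.of A A) := by
  have hn := (lUnit I).naturality H.counitHom
  simp only [Functor.id_map, Functor.comp_map] at hn
  unfold hatCounit
  rw [Functor.map_comp, ← Category.assoc, ← hn, Category.assoc, lUnit_comp_L0ToAdic]

theorem etaEta_comp_hatCounitTensor (M : ModuleCat.{u} A) :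
    H.etaEta I M ≫ H.hatCounitTensor I ((L0 I).obj M) = H.counitTensor M ≫ (lUnit I).app M := by
  refine BiMod.tensor_hom_ext fun m => ModuleCat.hom_ext (LinearMap.ext fun x => ?_)
  have h := ConcreteCategory.congr_hom (H.lUnit_comp_hatCounit I) x
  refine Eq.trans ?_ (((lUnit I).app M).hom.map_smul (H.counitHom.hom x) m).symm
  let n : (L0 I).obj M := ((lUnit I).app M).hom m
  exact congrArg (fun z : AdicCompletion I A => z • n) h

/-- The map `Ψ ⊗_A (Ψ ⊗_A M) → Ψ̂ ⊗_A (Ψ̂ ⊠ L_0 M)` induced by the unit of `L`-completion. -/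
noncomputable def etaTensorEta (M : ModuleCat.{u} A) :
    H.biMod.tensor.obj (H.biMod.tensor.obj M) ⟶
      (H.hatBiMod I).tensor.obj
        ((res I).obj ((H.box I).obj ((res I).obj ((L0 I).obj M)))) :=
  H.etaTensor I (H.biMod.tensor.obj M) ≫
    (H.hatBiMod I).tensor.map (H.etaEta I M ≫ (lUnit I).app _)

/-- For fixed `m`, the left side is η on Ψ followed by L_0(k), where `k` is built from the
uncompleted comultiplication; naturality of η rewrites it as `k` followed by η. -/
theorem etaEta_comp_hatComulTensor (M : ModuleCat.{u} A) :
    H.etaEta I M ≫ H.hatComulTensor I ((res I).obj ((L0 I).obj M)) =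
      H.comulTensor M ≫ H.etaTensorEta I M ≫ (lUnit I).app _ := by
  refine BiMod.tensor_hom_ext fun m => ?_
  let n := ((lUnit I).app M).hom m
  let k : H.biMod.left ⟶ (H.hatBiMod I).tensor.obj
      ((res I).obj ((H.box I).obj ((res I).obj ((L0 I).obj M)))) :=
    H.comulHom ≫ H.etaEta I H.biMod.left ≫ (H.hatBiMod I).tensor.map (H.hatTmul I n)
  have hk : H.comulHom ≫ H.biMod.tensorMap (H.biMod.tmul m) ≫ H.etaTensorEta I M = k := by
    refine congrArg (fun l => H.comulHom ≫ l) ?_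
    exact BiMod.tensor_hom_ext fun _ => rfl
  have h1 : H.biMod.tmul m ≫ H.etaEta I M ≫ H.hatComulTensor I ((res I).obj ((L0 I).obj M)) =
      (lUnit I).app H.biMod.left ≫
        (res I).map (H.hatComul I ≫ (H.box I).map (H.hatTmul I n)) := rfl
  have h2 : H.hatComul I ≫ (H.box I).map (H.hatTmul I n) = (L0 I).map k :=
    ((L0 I).map_comp _ _).symm.trans (congrArg (L0 I).map (Category.assoc _ _ _))
  refine h1.trans ((congrArg (fun l => (lUnit I).app H.biMod.left ≫ (res I).map l) h2).trans ?_)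
  exact ((lUnit I).naturality k).symm.trans (congrArg (fun l => l ≫ (lUnit I).app _) hk.symm)

theorem etaEta_comp_map_coact {M : ModuleCat.{u} A} (ψ : M ⟶ H.biMod.tensor.obj M) :
    H.etaEta I M ≫ (H.hatBiMod I).tensor.map ((res I).map ((L0 I).map (ψ ≫ H.etaEta I M))) =
      H.biMod.tensor.map ψ ≫ H.etaTensorEta I M := by
  have hn := (lUnit I).naturality (ψ ≫ H.etaEta I M)
  unfold etaTensorEta
  rw [← Category.assoc, H.etaTensor_naturality, Category.assoc, ← Functor.map_comp, etaEta,
    Category.assoc, ← Functor.map_comp]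
  refine congrArg (fun l => H.etaTensor I M ≫ (H.hatBiMod I).tensor.map l) ?_
  exact hn.symm.trans (Category.assoc _ _ _)

-- Each axiom is L_0 applied to the corresponding axiom for `ψ`, carried along η ⊗ η. The remaining
-- discrepancy between L_0(η) and η on an L-completion is removed by `res_map_L0_map_lUnit`.
variable {H} in
theorem isLComplete_L0 [IsNoetherianRing A] {M : ModuleCat.{u} A}
    {ψ : M ⟶ H.biMod.tensor.obj M} (hψ : H.IsCoaction ψ) :
    H.IsLComplete I (N := (L0 I).obj M) ((L0 I).map (ψ ≫ H.etaEta I M)) where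
  complete := isIso_lUnit_L0 I M
  counit := by
    have h : (ψ ≫ H.etaEta I M) ≫ H.hatCounitTensor I ((L0 I).obj M) = (lUnit I).app M := by
      rw [Category.assoc, etaEta_comp_hatCounitTensor]
      exact (Category.assoc _ _ _).symm.trans
        ((congrArg (fun k => k ≫ (lUnit I).app M) hψ.counit).trans (Category.id_comp _))
    refine Eq.trans ?_ (res_map_L0_map_lUnit M)
    exact congrArg (res I).map (((L0 I).map_comp _ _).symm.trans (congrArg (L0 I).map h))
  coassoc := by
    let Z := (H.hatBiMod I).tensor.obj
      ((res I).obj ((H.box I).obj ((res I).obj ((L0 I).obj M))))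
    have h1 : (ψ ≫ H.etaEta I M) ≫ H.hatComulTensor I ((res I).obj ((L0 I).obj M)) =
        (ψ ≫ H.biMod.tensor.map ψ ≫ H.etaTensorEta I M) ≫ (lUnit I).app Z := by
      rw [Category.assoc, etaEta_comp_hatComulTensor]
      exact (Category.assoc _ _ _).symm.trans
        ((congrArg (fun k => k ≫ H.etaTensorEta I M ≫ (lUnit I).app Z) hψ.coassoc).trans
          (by simp only [Category.assoc]))
    have h2 : (ψ ≫ H.etaEta I M) ≫ (H.hatBiMod I).tensor.map
        ((res I).map ((L0 I).map (ψ ≫ H.etaEta I M))) =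
          ψ ≫ H.biMod.tensor.map ψ ≫ H.etaTensorEta I M := by
      exact (Category.assoc _ _ _).trans
        (congrArg (fun k => ψ ≫ k) (H.etaEta_comp_map_coact I ψ))
    have h3 : (L0 I).map (ψ ≫ H.etaEta I M) ≫
        (H.box I).map ((res I).map ((L0 I).map (ψ ≫ H.etaEta I M))) =
          (L0 I).map (ψ ≫ H.biMod.tensor.map ψ ≫ H.etaTensorEta I M) :=
      ((L0 I).map_comp _ _).symm.trans (congrArg (L0 I).map h2)
    have h4 : (L0 I).map (ψ ≫ H.etaEta I M) ≫
        (L0 I).map (H.hatComulTensor I ((res I).obj ((L0 I).obj M))) =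
          (L0 I).map (ψ ≫ H.biMod.tensor.map ψ ≫ H.etaTensorEta I M) ≫
            (L0 I).map ((lUnit I).app Z) :=
      ((L0 I).map_comp _ _).symm.trans ((congrArg (L0 I).map h1).trans ((L0 I).map_comp _ _))
    refine (congrArg (res I).map h4).trans (((res I).map_comp _ _).trans ?_)
    exact congrArg₂ (fun k l => k ≫ l) (congrArg (res I).map h3.symm) (res_map_L0_map_lUnit Z)

/-! ### Flatness of Ψ for the right action -/

theorem flat_etaR (h : H.etaL.Flat) : H.etaR.Flat := by
  have hc : Function.Bijective H.conj :=
    Function.bijective_iff_has_inverse.2 ⟨H.conj, RingHom.congr_fun H.conj_conj,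
      RingHom.congr_fun H.conj_conj⟩
  -- The conjugation is a bijective ring map exchanging the units, so it carries flatness from η_L
  -- to η_R.
  rw [← H.conj_etaL]
  exact h.comp (RingHom.Flat.of_bijective hc)

theorem flat_biMod_right (h : H.etaL.Flat) : Module.Flat A H.biMod.Right := by
  let _ := H.etaR.toAlgebra
  have : Module.Flat A Ψ := H.flat_etaR h
  let e : Ψ ≃ₗ[A] H.biMod.Right :=
    { toFun := fun x => (x : Ψ)
      invFun := fun x => (x : Ψ)
      left_inv := fun _ => rfl
      right_inv := fun _ => rfl
      map_add' := fun _ _ => rfl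
      map_smul' := fun a x => mul_comm (H.etaR a) x }
  exact Module.Flat.of_linearEquiv e.symm

/-- The tensor product is formed over the right action, so flatness through η_R is what counts. It
is needed for 1 ⊗ i to be injective. -/
theorem tensorMap_injective (h : H.etaL.Flat) {M N : ModuleCat.{u} A} {g : M ⟶ N}
    (hg : Function.Injective g.hom) : Function.Injective (H.biMod.tensor.map g).hom := by
  have := H.flat_biMod_right h
  have hl := Module.Flat.lTensor_preserves_injective_linearMap (M := H.biMod.Right) g.hom hg
  have he : ∀ z : H.biMod.tensorObj M, (H.biMod.tensor.map g).hom z =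
      LinearMap.lTensor H.biMod.Right g.hom z := fun z => by
    induction z using BiMod.tensor_induction with
    | zero => exact (map_zero _).trans (map_zero _).symm
    | tmul b m => rfl
    | add x y hx hy =>
      exact (map_add _ x y).trans ((congrArg₂ (· + ·) hx hy).trans (map_add _ x y).symm)
  intro x y hxy
  exact hl ((he x).symm.trans (hxy.trans (he y)))

/-- The adjoint of the composite of the coaction of `L_0 M` with the map induced by
`F : L_0 M → N`. -/
theorem lUnit_comp_coact_comp_box_map {M N : ModuleCat.{u} A}
    (ψ : M ⟶ H.biMod.tensor.obj M) (F : (res I).obj ((L0 I).obj M) ⟶ N) :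
    (lUnit I).app M ≫ (res I).map ((L0 I).map (ψ ≫ H.etaEta I M) ≫ (H.box I).map F) =
      ψ ≫ H.biMod.tensor.map ((lUnit I).app M ≫ F) ≫ H.jMap I N := by
  have h1 : (L0 I).map (ψ ≫ H.etaEta I M) ≫ (H.box I).map F =
      (L0 I).map ((ψ ≫ H.etaEta I M) ≫ (H.hatBiMod I).tensor.map F) := ((L0 I).map_comp _ _).symm
  have h2 : (ψ ≫ H.etaEta I M) ≫ (H.hatBiMod I).tensor.map F =
      ψ ≫ H.biMod.tensor.map ((lUnit I).app M ≫ F) ≫ H.etaTensor I N := by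
    rw [Category.assoc]
    refine congrArg (fun k => ψ ≫ k) ?_
    rw [H.etaTensor_naturality]
    exact (Category.assoc _ _ _).trans (congrArg (fun k => H.etaTensor I M ≫ k)
      ((H.hatBiMod I).tensor.map_comp _ _).symm)
  refine (congrArg (fun k => (lUnit I).app M ≫ (res I).map k)
    (h1.trans (congrArg (L0 I).map h2))).trans ?_
  refine ((lUnit I).naturality _).symm.trans ?_
  exact (Category.assoc _ _ _).trans (congrArg (fun k => ψ ≫ k) (Category.assoc _ _ _))

/-! ### The correspondence between maps into νN and maps out of L_0 M -/

variable {I}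

theorem nu_condition (N : H.PreLComodule I) :
    H.nuI I N ≫ (res I).map N.coact = H.nuP I N ≫ H.jMap I ((res I).obj N.module) :=
  pullback.condition

variable {H}

/-- The map i ∘ g extends uniquely over η. Since Ψ̂ ⊠ N is L-complete, compatibility with coactions
may be tested on `M`, where it becomes the commutativity of the pullback square. -/
theorem existsUnique_preL0_hom [IsNoetherianRing A] {N : H.PreLComodule I}
    (hN : IsIso ((lUnit I).app ((res I).obj N.module)))
    {ρ : H.nu I N ⟶ H.biMod.tensor.obj (H.nu I N)} (hρ : H.IsCoaction ρ)
    (hcomm : ρ ≫ H.biMod.tensor.map (H.nuI I N) = H.nuP I N)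
    {M : H.Comodule} (g : M ⟶ H.nuComodule I N ρ hρ) :
    ∃! k : (H.preL0 I).obj M ⟶ N,
      (lUnit I).app M.module ≫ (res I).map k.hom = g.hom ≫ H.nuI I N := by
  let g₀ : M.module ⟶ H.nu I N := g.hom
  have hg : M.coact ≫ H.biMod.tensor.map g₀ = g₀ ≫ ρ := g.comm
  let f : M.module ⟶ (res I).obj N.module := g₀ ≫ H.nuI I N
  obtain ⟨F, hF, hF'⟩ := existsUnique_lUnit_comp_eq f
  refine ⟨⟨F, ?_⟩, hF, fun k hk => PreLComodule.hom_ext (hF' _ hk)⟩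
  have hc : IsIso ((lUnit I).app ((res I).obj ((H.box I).obj ((res I).obj N.module)))) :=
    isIso_lUnit_L0 I _
  refine (res I).map_injective (lUnit_hom_ext ?_)
  refine (H.lUnit_comp_coact_comp_box_map I M.coact ((res I).map F)).trans ?_
  have h1 : M.coact ≫ H.biMod.tensor.map f = g₀ ≫ H.nuP I N := by
    rw [Functor.map_comp, ← Category.assoc, hg, Category.assoc, hcomm]
  have h2 : (lUnit I).app M.module ≫ (res I).map (F ≫ N.coact) =
      f ≫ (res I).map N.coact := by
    rw [Functor.map_comp, ← hF]
    exact (Category.assoc _ _ _).symm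
  refine Eq.trans ?_ h2.symm
  rw [hF, ← Category.assoc, h1, Category.assoc, Category.assoc, nu_condition]

/-- Compatibility of `k` with coactions, restricted along η, is the condition for a map into the
pullback. That the resulting map respects coactions is checked after the monomorphism 1 ⊗ i;
uniqueness uses that i is mono. -/
theorem existsUnique_nuComodule_hom (hflat : H.etaL.Flat) {N : H.PreLComodule I}
    (hi : Function.Injective (H.nuI I N).hom)
    {ρ : H.nu I N ⟶ H.biMod.tensor.obj (H.nu I N)} (hρ : H.IsCoaction ρ)
    (hcomm : ρ ≫ H.biMod.tensor.map (H.nuI I N) = H.nuP I N)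
    {M : H.Comodule} (k : (H.preL0 I).obj M ⟶ N) :
    ∃! g : M ⟶ H.nuComodule I N ρ hρ,
      (lUnit I).app M.module ≫ (res I).map k.hom = g.hom ≫ H.nuI I N := by
  have hmono : Mono (H.nuI I N) := (ModuleCat.mono_iff_injective _).2 hi
  have hmono' : Mono (H.biMod.tensor.map (H.nuI I N)) :=
    (ModuleCat.mono_iff_injective _).2 (H.tensorMap_injective hflat hi)
  let k₀ : (L0 I).obj M.module ⟶ N.module := k.hom
  have hk : (L0 I).map (M.coact ≫ H.etaEta I M.module) ≫ (H.box I).map ((res I).map k₀) =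
      k₀ ≫ N.coact := k.comm
  let f : M.module ⟶ (res I).obj N.module := (lUnit I).app M.module ≫ (res I).map k₀
  have hf : f ≫ (res I).map N.coact =
      (M.coact ≫ H.biMod.tensor.map f) ≫ H.jMap I ((res I).obj N.module) := by
    refine (Category.assoc _ _ _).trans ?_
    refine (congrArg (fun l => (lUnit I).app M.module ≫ l) ((res I).map_comp _ _).symm).trans ?_
    refine (congrArg (fun l => (lUnit I).app M.module ≫ (res I).map l) hk.symm).trans ?_
    exact (H.lUnit_comp_coact_comp_box_map I M.coact ((res I).map k₀)).trans
      (Category.assoc _ _ _).symm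
  let g : M.module ⟶ H.nu I N := pullback.lift f (M.coact ≫ H.biMod.tensor.map f) hf
  have hgi : g ≫ H.nuI I N = f := pullback.lift_fst _ _ _
  have hgp : g ≫ H.nuP I N = M.coact ≫ H.biMod.tensor.map f := pullback.lift_snd _ _ _
  refine ⟨⟨g, ?_⟩, hgi.symm, fun g' hg' => Comodule.hom_ext ?_⟩
  · refine (cancel_mono (H.biMod.tensor.map (H.nuI I N))).1 ?_
    have h1 : (M.coact ≫ H.biMod.tensor.map g) ≫ H.biMod.tensor.map (H.nuI I N) =
        (g ≫ ρ) ≫ H.biMod.tensor.map (H.nuI I N) := by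
      rw [Category.assoc, ← Functor.map_comp, hgi, Category.assoc, hcomm, hgp]
    exact h1
  · exact (cancel_mono (H.nuI I N)).1 (hg'.symm.trans hgi.symm)

/-- The bijection between maps of `Ψ`-comodules `M → ν N` and maps of `Ψ̂`-comodules
`L_0 M → N`. -/
noncomputable def nuHomEquiv [IsNoetherianRing A] (hflat : H.etaL.Flat) {N : H.PreLComodule I}
    (hN : IsIso ((lUnit I).app ((res I).obj N.module)))
    (hi : Function.Injective (H.nuI I N).hom)
    {ρ : H.nu I N ⟶ H.biMod.tensor.obj (H.nu I N)} (hρ : H.IsCoaction ρ)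
    (hcomm : ρ ≫ H.biMod.tensor.map (H.nuI I N) = H.nuP I N) (M : H.Comodule) :
    (M ⟶ H.nuComodule I N ρ hρ) ≃ ((H.preL0 I).obj M ⟶ N) where
  toFun g := (existsUnique_preL0_hom hN hρ hcomm g).choose
  invFun k := (existsUnique_nuComodule_hom hflat hi hρ hcomm k).choose
  -- One equation, h ∘ η = i ∘ g, determines each of `g` and `k` from the other, so the two
  -- assignments are mutually inverse.
  left_inv g := ((existsUnique_nuComodule_hom hflat hi hρ hcomm _).choose_spec.2 g
    (existsUnique_preL0_hom hN hρ hcomm g).choose_spec.1).symm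
  right_inv k := ((existsUnique_preL0_hom hN hρ hcomm _).choose_spec.2 k
    (existsUnique_nuComodule_hom hflat hi hρ hcomm k).choose_spec.1).symm

section

variable [IsNoetherianRing A] (hflat : H.etaL.Flat) {N : H.PreLComodule I}
  (hN : IsIso ((lUnit I).app ((res I).obj N.module)))
  (hi : Function.Injective (H.nuI I N).hom)
  {ρ : H.nu I N ⟶ H.biMod.tensor.obj (H.nu I N)} (hρ : H.IsCoaction ρ)
  (hcomm : ρ ≫ H.biMod.tensor.map (H.nuI I N) = H.nuP I N)

theorem lUnit_comp_nuHomEquiv {M : H.Comodule} (g : M ⟶ H.nuComodule I N ρ hρ) :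
    (lUnit I).app M.module ≫ (res I).map (nuHomEquiv hflat hN hi hρ hcomm M g).hom =
      g.hom ≫ H.nuI I N :=
  (existsUnique_preL0_hom hN hρ hcomm g).choose_spec.1

/-- By naturality of η, both sides restrict along η to i ∘ g ∘ f, so uniqueness of the extension
applies. -/
theorem nuHomEquiv_comp {M M' : H.Comodule} (f : M ⟶ M') (g : M' ⟶ H.nuComodule I N ρ hρ) :
    nuHomEquiv hflat hN hi hρ hcomm M (f ≫ g) =
      (H.preL0 I).map f ≫ nuHomEquiv hflat hN hi hρ hcomm M' g := by
  refine ((existsUnique_preL0_hom hN hρ hcomm (f ≫ g)).choose_spec.2 _ ?_).symm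
  have h := lUnit_comp_nuHomEquiv hflat hN hi hρ hcomm g
  have hn : f.hom ≫ (lUnit I).app M'.module =
      (lUnit I).app M.module ≫ (res I).map ((L0 I).map f.hom) := (lUnit I).naturality f.hom
  have h1 : f.hom ≫ (lUnit I).app M'.module ≫
      (res I).map (nuHomEquiv hflat hN hi hρ hcomm M' g).hom =
        (f.hom ≫ g.hom) ≫ H.nuI I N :=
    (congrArg (fun k => f.hom ≫ k) h).trans (Category.assoc _ _ _).symm
  refine Eq.trans ?_ h1
  refine Eq.trans ?_ (Category.assoc _ _ _)
  refine Eq.trans ?_ (congrArg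
    (fun k => k ≫ (res I).map (nuHomEquiv hflat hN hi hρ hcomm M' g).hom) hn.symm)
  exact (congrArg (fun k => (lUnit I).app M.module ≫ k) ((res I).map_comp _ _)).trans
    (Category.assoc _ _ _).symm

end

end HopfAlgebroid

/-! ### The theorem: representability by νN and comparison with a right adjoint -/

theorem mainTheorem3 {A Ψ : Type u} [CommRing A] [IsRegularLocalRing A] [CommRing Ψ]
    (I : Ideal A) (hI : I = IsLocalRing.maximalIdeal A)
    (H : HopfAlgebroid A Ψ) (hflat : H.etaL.Flat)
    (hinv : I.map H.etaL = I.map H.etaR)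
    (N : H.LComodule I)
    (hi : Function.Injective (H.nuI I N.obj).hom)
    (ρ : H.nu I N.obj ⟶ H.biMod.tensor.obj (H.nu I N.obj))
    (hρ : H.IsCoaction ρ)
    (hcomm : ρ ≫ H.biMod.tensor.map (H.nuI I N.obj) = H.nuP I N.obj) :
    ∃ hL : ∀ M : H.Comodule, H.isLComodule I ((H.preL0 I).obj M),
      (∃ Φ : ((H.L0Comodule I hL).op ⋙ yoneda.obj N).RepresentableBy
            (H.nuComodule I N.obj ρ hρ),
          ∀ (M : H.Comodule) (g : M ⟶ H.nuComodule I N.obj ρ hρ),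
            (lUnit I).app M.module ≫ (res I).map (Φ.homEquiv g).hom.hom =
              g.hom ≫ H.nuI I N.obj) ∧
        ∀ ι : H.LComodule I ⥤ H.Comodule, (H.L0Comodule I hL ⊣ ι) →
          Nonempty (H.nuComodule I N.obj ρ hρ ≅ ι.obj N) := by
  have hL : ∀ M : H.Comodule, H.isLComodule I ((H.preL0 I).obj M) := fun M =>
    HopfAlgebroid.isLComplete_L0 I M.isCoaction
  have hN : IsIso ((lUnit I).app ((res I).obj N.obj.module)) := N.property.complete
  let Φ : ((H.L0Comodule I hL).op ⋙ yoneda.obj N).RepresentableBy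
      (H.nuComodule I N.obj ρ hρ) :=
    { homEquiv := fun {M} => (HopfAlgebroid.nuHomEquiv hflat hN hi hρ hcomm M).trans
        -- L-complete comodules form a full subcategory, so its morphisms are those of the ambient
        -- category in a wrapper.
        (InducedCategory.homEquiv (F := ObjectProperty.FullSubcategory.obj)
          (X := (H.L0Comodule I hL).obj M) (Y := N)).symm
      homEquiv_comp := fun f g => ObjectProperty.hom_ext _
        (HopfAlgebroid.nuHomEquiv_comp hflat hN hi hρ hcomm f g) }
  refine ⟨hL, ⟨Φ, fun M g => HopfAlgebroid.lUnit_comp_nuHomEquiv hflat hN hi hρ hcomm g⟩,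
    -- The adjunction makes ιN represent the same functor as νN, and representing objects are unique
    -- up to isomorphism.
    fun ι adj => ⟨Φ.uniqueUpToIso (adj.representableBy N)⟩⟩
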